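/- Let $H$ be a separable complex Hilbert space, $A$ a self-adjoint operator in $H$ whose domain $H_A$ (with the graph norm) embeds compactly into $H$, and $\gamma$ a bounded operator on $H$ with $-\gamma=\gamma^*=\gamma^{-1}$, $\gamma(H_A)\subset H_A$ and $A\gamma+\gamma A=0$ on $H_A$ (a Dirac system with constant coefficients). Let $\mathcal L_c$ be the space of locally Lipschitz functions $\sigma:[0,\infty)\to H$ with compact support that are locally essentially bounded as functions to $H_A$, put $D\sigma=\gamma(\sigma'+A\sigma)$ for $\sigma\in\mathcal L_c$ (with $\sigma'$ the almost everywhere defined weak derivative), and let $D_{0,c}$ be the restriction of $D$ to $\{\sigma\in\mathcal L_c:\sigma(0)=0\}$, considered as an unbounded operator in $L^2([0,\infty),H)$. Let $D_{\max}=(D_{0,c})^*$, with domain $\mathcal D_{\max}$ carrying the graph norm. For $s\in\mathbb R$ let $H^s$ be the Sobolev space of $A$ with norm $\|(I+A^2)^{s/2}x\|$, that is, the space of formal sums $\sum_r x_r$ of eigenvectors $x_r\in\ker(A-r)$, $r\in\mathbb R$, with $\|x\|_s^2=\sum_r(1+r^2)^s\|x_r\|^2<\infty$; let $H^s_>$ and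 $H^s_<$ be the subspaces of those $x$ with $x_r=0$ for $r\le0$ and for $r\ge 0$, respectively; let $Q_0$ be the orthogonal projection onto $\ker A$; and let $$\check H=H^{-1/2}_>\oplus Q_0H\oplus H^{1/2}_<.$$ The restriction map $\sigma\mapsto\sigma(0)$, $\sigma\in\mathcal L_c$, has a unique extension to a continuous linear map $\mathcal D_{\max}\to\check H$, and $\sigma(0)\in\check H$ denotes the image of $\sigma\in\mathcal D_{\max}$ under it. For a linear subspace $B\subset\check H$ let $D_{B,\max}$ be the restriction of $D_{\max}$ to $\{\sigma\in\mathcal D_{\max}:\sigma(0)\in B\}$. Then: 1. If $\bar D$ is a closed operator with $D_{0,c}\subset\bar D\subset D_{\max}$ and domain $\bar{\mathcal D}$, then $B=\{\sigma(0):\sigma\in\bar{\mathcal D}\}$ is a closed subspace of $\check H$, and $\bar D=D_{B,\max}$. 2. Conversely, if $B$ is a closed subspace of $\check H$, then $D_{B,\max}$ is a closed operator with $D_{0,c}\subset D_{B,\max}\subset D_{\max}$, and $\{\sigma(0):\sigma\in\operatorname{dom}D_{B,\max}\}=B$. Hence $\bar D\mapsto B$ and $B\mapsto D_{B,\max}$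 are inverse bijections between the closed extensions of $D_{0,c}$ that are contained in $D_{\max}$ and the closed subspaces of $\check H$. -/

import Mathlib

open MeasureTheory Set
open scoped ENNReal InnerProductSpace

noncomputable section

/-- A Dirac system `(H, A, γ)` with constant coefficients: a (densely defined, unbounded)
self-adjoint operator `A` in `H` whose domain, with the graph norm, embeds compactly into `H`,
and a bounded operator `γ` with `-γ = γ* = γ⁻¹` which preserves the domain of `A` and
anticommutes with `A` there. The space `H_A` is modelled by the graph of `A` in `H × H`. -/
structure DiracSystem (H : Type*) [NormedAddCommGroup H] [InnerProductSpace ℂ H]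
    [CompleteSpace H] where
  A : H →ₗ.[ℂ] H
  selfAdjoint : IsSelfAdjoint A
  compactEmbedding : IsCompactOperator (fun p : A.graph => (p : H × H).1)
  γ : H →L[ℂ] H
  γ_adjoint : ContinuousLinearMap.adjoint γ = -γ
  γ_sq : ∀ x : H, γ (γ x) = -x
  γ_domain : ∀ x ∈ A.domain, γ x ∈ A.domain
  γ_anticomm : ∀ x : A.domain, A ⟨γ x, γ_domain x x.2⟩ + γ (A x) = 0

/-- Lebesgue measure on the half-line `[0, ∞)`. -/
abbrev halfLine : Measure ℝ := volume.restrict (Ici 0)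

/-- The Hilbert space `L²([0, ∞), H)`. -/
abbrev HalfLineL2 (H : Type*) [NormedAddCommGroup H] : Type _ := Lp H 2 halfLine

/-- `v` is the weak derivative at `t` of the `H`-valued function `τ` on `[0, ∞)`. -/
def HasWeakDerivAt {H : Type*} [NormedAddCommGroup H] [InnerProductSpace ℂ H]
    (τ : ℝ → H) (v : H) (t : ℝ) : Prop :=
  ∀ u : H, HasDerivWithinAt (fun s : ℝ => ⟪u, τ s⟫_ℂ) ⟪u, v⟫_ℂ (Ici 0) t

/-- The locally Lipschitz functions `[0, ∞) → H` which are locally essentially bounded as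
functions to `H_A` and have compact support. (Functions are defined on all of `ℝ`, but only
their values on `[0, ∞)` matter.) -/
structure IsCompactLip {H : Type*} [NormedAddCommGroup H] [InnerProductSpace ℂ H]
    [CompleteSpace H] (d : DiracSystem H) (τ : ℝ → H) : Prop where
  lipschitz : ∀ T : ℝ, ∃ K : NNReal, LipschitzOnWith K τ (Icc 0 T)
  bounded : ∀ T : ℝ, ∃ C : ℝ, ∀ᵐ t ∂(volume.restrict (Icc 0 T)),
    ∃ h : τ t ∈ d.A.domain, ‖d.A ⟨τ t, h⟩‖ ≤ C
  compactSupport : ∃ T : ℝ, ∀ t : ℝ, T ≤ t → τ t = 0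

/-- `g = γ (τ' + A τ)` almost everywhere on `[0, ∞)`. -/
def IsDiracImage {H : Type*} [NormedAddCommGroup H] [InnerProductSpace ℂ H]
    [CompleteSpace H] (d : DiracSystem H) (τ g : ℝ → H) : Prop :=
  ∀ᵐ t ∂halfLine, ∃ v : H, HasWeakDerivAt τ v t ∧
    ∃ h : τ t ∈ d.A.domain, g t = d.γ (v + d.A ⟨τ t, h⟩)

namespace DiracSystem

variable {H : Type*} [NormedAddCommGroup H] [InnerProductSpace ℂ H] [CompleteSpace H]

/-! ### The operators -/

/-- The graph in `L² × L²` of the Dirac operator on the Lipschitz functions with compact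
support in `[0, ∞)` that vanish at `0`. -/
def graphZeroC (d : DiracSystem H) : Submodule ℂ (HalfLineL2 H × HalfLineL2 H) where
  carrier := {p | ∃ τ : ℝ → H, IsCompactLip d τ ∧ τ 0 = 0 ∧
    p.1 =ᵐ[halfLine] τ ∧ IsDiracImage d τ p.2}
  zero_mem' := by
    refine ⟨fun _ => 0, ⟨fun T => ⟨0, ?_⟩, fun T => ⟨0, ?_⟩, 0, fun _ _ => rfl⟩, rfl,
      Lp.coeFn_zero H 2 halfLine, ?_⟩
    · intro x _ y _; simp
    · refine Filter.Eventually.of_forall fun t => ⟨d.A.domain.zero_mem, ?_⟩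
      have : d.A ⟨0, d.A.domain.zero_mem⟩ = 0 := d.A.map_zero
      simp [this]
    · filter_upwards [Lp.coeFn_zero H 2 halfLine] with t ht
      refine ⟨0, fun u => by simpa using hasDerivWithinAt_const t (Ici (0:ℝ)) (0:ℂ),
        d.A.domain.zero_mem, ?_⟩
      have : d.A ⟨0, d.A.domain.zero_mem⟩ = 0 := d.A.map_zero
      simpa [this] using ht
  add_mem' := by
    rintro p q ⟨τ, hτ, hτ0, hpτ, hD⟩ ⟨ρ, hρ, hρ0, hqρ, hE⟩
    refine ⟨fun t => τ t + ρ t, ⟨fun T => ?_, fun T => ?_, ?_⟩, by simp [hτ0, hρ0], ?_, ?_⟩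
    · obtain ⟨K, hK⟩ := hτ.lipschitz T
      obtain ⟨L, hL⟩ := hρ.lipschitz T
      exact ⟨K + L, hK.add hL⟩
    · obtain ⟨C, hC⟩ := hτ.bounded T
      obtain ⟨C', hC'⟩ := hρ.bounded T
      refine ⟨C + C', ?_⟩
      filter_upwards [hC, hC'] with t ⟨h, hb⟩ ⟨h', hb'⟩
      refine ⟨d.A.domain.add_mem h h', ?_⟩
      have : d.A ⟨τ t + ρ t, d.A.domain.add_mem h h'⟩ = d.A ⟨τ t, h⟩ + d.A ⟨ρ t, h'⟩ :=
        d.A.map_add ⟨τ t, h⟩ ⟨ρ t, h'⟩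
      rw [this]
      exact (norm_add_le _ _).trans (add_le_add hb hb')
    · obtain ⟨T, hT⟩ := hτ.compactSupport
      obtain ⟨T', hT'⟩ := hρ.compactSupport
      refine ⟨max T T', fun t ht => ?_⟩
      simp [hT t (le_trans (le_max_left _ _) ht), hT' t (le_trans (le_max_right _ _) ht)]
    · filter_upwards [Lp.coeFn_add p.1 q.1, hpτ, hqρ] with t h1 h2 h3
      rw [Prod.fst_add, h1, Pi.add_apply, h2, h3]
    · filter_upwards [Lp.coeFn_add p.2 q.2, hD, hE] with t h1 ⟨v, hv, h, hg⟩ ⟨w, hw, h', hg'⟩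
      refine ⟨v + w, fun u => ?_, d.A.domain.add_mem h h', ?_⟩
      · simpa [inner_add_right] using (hv u).fun_add (hw u)
      · have : d.A ⟨τ t + ρ t, d.A.domain.add_mem h h'⟩ = d.A ⟨τ t, h⟩ + d.A ⟨ρ t, h'⟩ :=
          d.A.map_add ⟨τ t, h⟩ ⟨ρ t, h'⟩
        rw [Prod.snd_add, h1, Pi.add_apply, hg, hg', this, ← map_add]
        congr 1
        abel
  smul_mem' := by
    rintro c p ⟨τ, hτ, hτ0, hpτ, hD⟩
    refine ⟨fun t => c • τ t, ⟨fun T => ?_, fun T => ?_, ?_⟩, by simp [hτ0], ?_, ?_⟩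
    · obtain ⟨K, hK⟩ := hτ.lipschitz T
      exact ⟨‖c‖₊ * K, (lipschitzWith_smul c).comp_lipschitzOnWith hK⟩
    · obtain ⟨C, hC⟩ := hτ.bounded T
      refine ⟨‖c‖ * C, ?_⟩
      filter_upwards [hC] with t ⟨h, hb⟩
      refine ⟨d.A.domain.smul_mem c h, ?_⟩
      have : d.A ⟨c • τ t, d.A.domain.smul_mem c h⟩ = c • d.A ⟨τ t, h⟩ :=
        d.A.map_smul c ⟨τ t, h⟩
      rw [this, norm_smul]
      exact mul_le_mul_of_nonneg_left hb (norm_nonneg c)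
    · obtain ⟨T, hT⟩ := hτ.compactSupport
      exact ⟨T, fun t ht => by simp [hT t ht]⟩
    · filter_upwards [Lp.coeFn_smul c p.1, hpτ] with t h1 h2
      rw [Prod.smul_fst, h1, Pi.smul_apply, h2]
    · filter_upwards [Lp.coeFn_smul c p.2, hD] with t h1 ⟨v, hv, h, hg⟩
      refine ⟨c • v, fun u => ?_, d.A.domain.smul_mem c h, ?_⟩
      · simpa [inner_smul_right] using (hv u).const_mul c
      · have : d.A ⟨c • τ t, d.A.domain.smul_mem c h⟩ = c • d.A ⟨τ t, h⟩ :=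
          d.A.map_smul c ⟨τ t, h⟩
        rw [Prod.smul_snd, h1, Pi.smul_apply, hg, this, ← smul_add, map_smul]

/-- `D_{0,c}`: the Dirac operator `γ (∂ₜ + A)` on the Lipschitz functions with compact support
in `[0, ∞)` that vanish at `0`, as an unbounded operator in `L²([0, ∞), H)`. -/
def DZeroC (d : DiracSystem H) : HalfLineL2 H →ₗ.[ℂ] HalfLineL2 H :=
  d.graphZeroC.toLinearPMap

/-- The graph of `D_{0,c}` is the submodule that it was defined from. -/
theorem DZeroC_graph (d : DiracSystem H) : d.DZeroC.graph = d.graphZeroC := by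
  refine Submodule.toLinearPMap_graph_eq _ ?_
  rintro ⟨f, g⟩ ⟨τ, hτ, hτ0, hfτ, hD⟩ hf
  simp only at hf hfτ hD ⊢
  subst hf
  have hz : τ =ᵐ[halfLine] fun _ => (0 : H) := hfτ.symm.trans (Lp.coeFn_zero H 2 halfLine)
  have hcont : ContinuousOn τ (Ici 0) := by
    intro x hx
    obtain ⟨K, hK⟩ := hτ.lipschitz (x + 1)
    have h1 : ContinuousWithinAt τ (Icc 0 (x + 1)) x :=
      hK.continuousOn x ⟨hx, by linarith⟩
    refine h1.mono_of_mem_nhdsWithin ?_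
    rw [← Ici_inter_Iic]
    exact Filter.inter_mem self_mem_nhdsWithin
      (mem_nhdsWithin_of_mem_nhds (Iic_mem_nhds (by linarith)))
  have hzero : EqOn τ (fun _ => (0 : H)) (Ioi 0) := by
    refine Measure.eqOn_open_of_ae_eq (μ := (volume : Measure ℝ)) ?_ isOpen_Ioi
      (hcont.mono Ioi_subset_Ici_self) continuousOn_const
    exact ae_restrict_of_ae_restrict_of_subset Ioi_subset_Ici_self hz
  have hall : ∀ t ∈ Ici (0:ℝ), τ t = 0 := by
    intro t ht
    rcases eq_or_lt_of_le (mem_Ici.1 ht) with h | h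
    · rw [← h, hτ0]
    · exact hzero h
  refine Lp.ext ?_
  filter_upwards [hD, Lp.coeFn_zero H 2 halfLine, ae_restrict_mem measurableSet_Ici]
    with t ⟨v, hv, h, hg⟩ h0 ht
  rw [hg, h0]
  have hv0 : v = 0 := by
    have h2 : HasDerivWithinAt (fun s : ℝ => ⟪v, τ s⟫_ℂ) 0 (Ici 0) t :=
      (hasDerivWithinAt_const t (Ici (0:ℝ)) (0:ℂ)).congr
        (fun s hs => by simp [hall s hs]) (by simp [hall t ht])
    have := (uniqueDiffOn_Ici (0:ℝ) t ht).eq_deriv _ (hv v) h2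
    exact inner_self_eq_zero.1 this
  have hA : d.A ⟨τ t, h⟩ = 0 := by
    have : (⟨τ t, h⟩ : d.A.domain) = 0 := Subtype.ext (hall t ht)
    rw [this]; exact d.A.map_zero
  simp [hv0, hA]

/-- The maximal extension `D_max = (D_{0,c})*`. -/
def DMax (d : DiracSystem H) : HalfLineL2 H →ₗ.[ℂ] HalfLineL2 H := d.DZeroC.adjoint

/-! ### The Sobolev scale of `A` and the space of boundary values -/

/-- The kernel of `A - r`: an eigenspace of `A` if `r` is an eigenvalue, `0` otherwise. -/
def eigenspace (d : DiracSystem H) (r : ℝ) : Submodule ℂ H where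
  carrier := {x | (x, (r : ℂ) • x) ∈ d.A.graph}
  zero_mem' := by
    change ((0 : H), (r : ℂ) • (0 : H)) ∈ d.A.graph
    rw [smul_zero]
    exact d.A.graph.zero_mem
  add_mem' := by
    intro x y hx hy
    simpa using d.A.graph.add_mem hx hy
  smul_mem' := by
    intro c x hx
    have := d.A.graph.smul_mem c hx
    rw [Prod.smul_mk, smul_comm] at this
    exact this

theorem isClosed_eigenspace (d : DiracSystem H) (r : ℝ) :
    IsClosed (d.eigenspace r : Set H) := by
  have h : IsClosed (d.A.graph : Set (H × H)) := d.selfAdjoint.isClosed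
  exact h.preimage (by fun_prop : Continuous fun x : H => (x, (r : ℂ) • x))

instance (d : DiracSystem H) (r : ℝ) : CompleteSpace (d.eigenspace r) :=
  (d.isClosed_eigenspace r).completeSpace_coe

/-- The weight `(1 + r²)^{s/2}`. -/
def sobolevWeight (s r : ℝ) : ℂ := (((1 + r ^ 2) ^ (s / 2) : ℝ) : ℂ)

/-- The families `(x_r)` of eigenvectors, `x_r ∈ ker (A - r)`, with
`∑ (1 + r²)^s ‖x_r‖² < ∞`. -/
def sobolevFamilies (d : DiracSystem H) (s : ℝ) : Submodule ℂ (∀ r : ℝ, d.eigenspace r) where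
  carrier := {x | Memℓp (fun r : ℝ => sobolevWeight s r • x r) 2}
  zero_mem' := by
    change Memℓp _ 2
    convert! (zero_memℓp : Memℓp (0 : ∀ r : ℝ, d.eigenspace r) 2) using 2 with r
    exact smul_zero _
  add_mem' := by
    intro x y hx hy
    change Memℓp _ 2
    convert! hx.add hy using 2 with r
    exact smul_add _ _ _
  smul_mem' := by
    intro c x hx
    have := Memℓp.const_smul hx c
    change Memℓp _ 2
    convert! this using 2 with r
    exact smul_comm (sobolevWeight s r) c (x r)

/-- The Sobolev space `H^s` of `A`, for `s ∈ ℝ`: the completion of `⋂ₙ dom Aⁿ` for the norm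
`‖(1 + A²)^{s/2} x‖`. As `A` has an orthogonal decomposition into eigenspaces, this completion
is the space of formal sums `∑ x_r` of eigenvectors `x_r ∈ ker (A - r)` for which
`‖x‖_s² = ∑ (1 + r²)^s ‖x_r‖²` is finite. -/
def Sobolev (d : DiracSystem H) (s : ℝ) : Type _ := d.sobolevFamilies s

instance (d : DiracSystem H) (s : ℝ) : AddCommGroup (d.Sobolev s) :=
  inferInstanceAs (AddCommGroup (d.sobolevFamilies s))

instance (d : DiracSystem H) (s : ℝ) : Module ℂ (d.Sobolev s) :=
  inferInstanceAs (Module ℂ (d.sobolevFamilies s))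

/-- The component of `x ∈ H^s` in `ker (A - r)`. -/
def Sobolev.component {d : DiracSystem H} {s : ℝ} (r : ℝ) :
    d.Sobolev s →ₗ[ℂ] d.eigenspace r :=
  (LinearMap.proj r).comp (d.sobolevFamilies s).subtype

/-- The map `(1 + A²)^{s/2}` from `H^s` to the Hilbert sum of the spaces `ker (A - r)`. -/
def Sobolev.weighted {d : DiracSystem H} {s : ℝ} :
    d.Sobolev s →ₗ[ℂ] lp (fun r : ℝ => d.eigenspace r) 2 where
  toFun x := ⟨fun r => sobolevWeight s r • Sobolev.component r x, x.2⟩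
  map_add' x y := by
    refine Subtype.ext (funext fun r => ?_)
    change sobolevWeight s r • Sobolev.component r (x + y) =
      sobolevWeight s r • Sobolev.component r x +
      sobolevWeight s r • Sobolev.component r y
    rw [map_add, smul_add]
  map_smul' c x := by
    refine Subtype.ext (funext fun r => ?_)
    change sobolevWeight s r • Sobolev.component r (c • x) =
      c • sobolevWeight s r • Sobolev.component r x
    rw [map_smul, smul_comm]

theorem Sobolev.weighted_injective {d : DiracSystem H} {s : ℝ} :
    Function.Injective (Sobolev.weighted : d.Sobolev s →ₗ[ℂ] _) := by
  intro x y h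
  refine Subtype.ext (funext fun r => ?_)
  have h1 : sobolevWeight s r • Sobolev.component r x =
      sobolevWeight s r • Sobolev.component r y :=
    congrFun (congrArg Subtype.val h) r
  have h2 : sobolevWeight s r ≠ 0 := by
    unfold sobolevWeight
    exact_mod_cast (Real.rpow_pos_of_pos (by positivity) _).ne'
  exact smul_right_injective _ h2 h1

instance (d : DiracSystem H) (s : ℝ) : NormedAddCommGroup (d.Sobolev s) :=
  NormedAddCommGroup.induced _ _ (Sobolev.weighted (d := d) (s := s))
    Sobolev.weighted_injective

instance (d : DiracSystem H) (s : ℝ) : NormedSpace ℂ (d.Sobolev s) :=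
  NormedSpace.induced ℂ (d.Sobolev s) (lp (fun r : ℝ => d.eigenspace r) 2) Sobolev.weighted

theorem Sobolev.hasSum_norm_sq {d : DiracSystem H} {s : ℝ} (x : d.Sobolev s) :
    HasSum (fun r : ℝ => (1 + r ^ 2) ^ s * ‖Sobolev.component r x‖ ^ 2) (‖x‖ ^ 2) := by
  have h := lp.hasSum_norm (p := 2) (by norm_num) (Sobolev.weighted x)
  simp only [ENNReal.toReal_ofNat, Real.rpow_two] at h
  convert! h using 2 with r
  have h0 : (0:ℝ) ≤ 1 + r ^ 2 := by positivity
  change _ = ‖sobolevWeight s r • Sobolev.component r x‖ ^ 2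
  rw [norm_smul, mul_pow, sobolevWeight, Complex.norm_real, Real.norm_of_nonneg (Real.rpow_nonneg h0 _),
    ← Real.rpow_mul_natCast h0]
  congr 2
  push_cast
  ring

/-- The subspace `H^s_J = Q_J (H^s)` of `H^s`, for a set `J` of spectral parameters. -/
def SobolevOn (d : DiracSystem H) (s : ℝ) (J : Set ℝ) : Submodule ℂ (d.Sobolev s) where
  carrier := {x | ∀ r : ℝ, r ∉ J → Sobolev.component r x = 0}
  zero_mem' := fun r _ => map_zero _
  add_mem' := fun hx hy r hr => by rw [map_add, hx r hr, hy r hr, add_zero]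
  smul_mem' := fun c _ hx r hr => by rw [map_smul, hx r hr, smul_zero]

/-- The space of boundary values `Ȟ = H^{-1/2}_> ⊕ Q₀ H ⊕ H^{1/2}_<`, where
`Q₀ H = ker A`. -/
abbrev CheckH (d : DiracSystem H) : Type _ :=
  d.SobolevOn (-(1 / 2)) (Ioi 0) × d.eigenspace 0 × d.SobolevOn (1 / 2) (Iio 0)

/-- The element `X` of `Ȟ` is (the image in `Ȟ` of) the vector `x` of `H`: their components
in all eigenspaces of `A` agree. -/
def IsVector (d : DiracSystem H) (X : d.CheckH) (x : H) : Prop :=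
  (∀ r : ℝ, 0 < r →
    ((Sobolev.component r (X.1 : d.Sobolev (-(1 / 2))) : d.eigenspace r) : H) =
      (d.eigenspace r).starProjection x) ∧
  ((X.2.1 : H) = (d.eigenspace 0).starProjection x) ∧
  (∀ r : ℝ, r < 0 →
    ((Sobolev.component r (X.2.2 : d.Sobolev (1 / 2)) : d.eigenspace r) : H) =
      (d.eigenspace r).starProjection x)

/-! ### Boundary values and boundary conditions -/

/-- `R` extends the restriction map `τ ↦ τ(0)` from the compactly supported Lipschitz functions
to the domain of `D_max`. The domain of `D_max`, with the graph norm, is modelled by the graph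
of `D_max` in `L² × L²`, so `R` is continuous for the graph norm; then `σ(0) := R σ`. -/
def IsBoundaryMap (d : DiracSystem H) (R : d.DMax.graph →L[ℂ] d.CheckH) : Prop :=
  ∀ τ : ℝ → H, IsCompactLip d τ →
    ∀ p : d.DMax.graph, (p : HalfLineL2 H × HalfLineL2 H).1 =ᵐ[halfLine] τ →
      d.IsVector (R p) (τ 0)

/-- `{σ(0) : σ ∈ dom E}`, for `E ⊂ D_max`. -/
def boundaryValues (d : DiracSystem H) (R : d.DMax.graph →L[ℂ] d.CheckH)
    (E : HalfLineL2 H →ₗ.[ℂ] HalfLineL2 H) : Submodule ℂ d.CheckH :=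
  (E.domain.comap
    ((LinearMap.fst ℂ (HalfLineL2 H) (HalfLineL2 H)).comp d.DMax.graph.subtype)).map
      (R : d.DMax.graph →ₗ[ℂ] d.CheckH)

/-- `D_{B,max}`: the restriction of `D_max` to `{σ ∈ dom D_max : σ(0) ∈ B}`. -/
def DBMax (d : DiracSystem H) (R : d.DMax.graph →L[ℂ] d.CheckH)
    (B : Submodule ℂ d.CheckH) : HalfLineL2 H →ₗ.[ℂ] HalfLineL2 H :=
  d.DMax.domRestrict ((B.comap (R : d.DMax.graph →ₗ[ℂ] d.CheckH)).map
    ((LinearMap.fst ℂ (HalfLineL2 H) (HalfLineL2 H)).comp d.DMax.graph.subtype))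

end DiracSystem

end

/-! Because `dom A` embeds compactly, `(1 + A²)⁻¹` is compact, so the eigenvectors of `A` are total
in `H`, and `γ` exchanges `ker (A - r)` and `ker (A + r)`. Pairing with eigenvectors reduces `D_max
σ = g` to scalar equations on the half-line.

The classification is formal once the boundary map `R : dom D_max → Ȟ` is known to be continuous, to
have a continuous linear right inverse `S`, and to have the closure of `D_{0,c}` as its kernel
(`exists_boundaryMap`). A closed extension `E` then contains `ker R`, so `E = R⁻¹(B)`, and `B =
S⁻¹(E)` is closed. Conversely `R⁻¹(B)` is closed for closed `B`, and `R` maps it onto `B`.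

Both `R` and `S` are built from the model extensions `e^{-t√(1+r²)} (1-t)₊ x` of `x ∈ ker (A - r)`.
Their graph norm is at most a constant times `w(r) ‖x‖`, where `w(r)` is the weight of `Ȟ`:
`(1+r²)^{-1/4}` for `r > 0`, `(1+r²)^{1/4}` for `r ≤ 0` (`norm_modelPair_fst_le`,
`norm_modelPair_snd_le`). Different eigenvalues give orthogonal extensions, so they can be summed to
`S`. By Green's formula (`inner_modelPair_eq`) the component of `σ(0)` along `z ∈ ker (A - r)` is a
pairing of `(σ, D_max σ)` with the model extension of `γ z`, which lives at `-r`. As `w(-r) =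
w(r)⁻¹`, these pairings form a bounded operator, the source of `R` (`exists_boundaryOperator`).

For the kernel, take an element with boundary value `0` and subtract its orthogonal projection onto
the closed graph of `D_{0,c}`. What is left is a pair `(σ, g)` with `D_max σ = g`, `D_max g = -σ`
and boundary value `0`. Its coefficients solve `a' = s a - w`, `w' = -s w - a`, `a(0) = 0`; since
`Re (a w̄)` is nonincreasing, integrable and `0` at `0`, they vanish
(`ae_eq_zero_of_hyperbolic_system`, `eq_zero_of_mem_deficiency`, `mem_closure_graphZeroC`). -/

noncomputable section

namespace DiracSystem

variable {H : Type*} [NormedAddCommGroup H] [InnerProductSpace ℂ H] [CompleteSpace H]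

/-! ### The spectral theorem for `A` -/

theorem mem_eigenspace_iff (d : DiracSystem H) {r : ℝ} {x : H} :
    x ∈ d.eigenspace r ↔ ∃ h : x ∈ d.A.domain, d.A ⟨x, h⟩ = (r : ℂ) • x := by
  change (x, (r : ℂ) • x) ∈ d.A.graph ↔ _
  simp only [LinearPMap.mem_graph_iff, Subtype.exists]
  constructor
  · rintro ⟨a, h, rfl, h2⟩
    exact ⟨h, h2⟩
  · rintro ⟨h, h2⟩
    exact ⟨x, h, rfl, h2⟩

theorem A_inner (d : DiracSystem H) (x y : d.A.domain) :
    ⟪d.A x, (y : H)⟫_ℂ = ⟪(x : H), d.A y⟫_ℂ := by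
  have h := d.A.adjoint_isFormalAdjoint d.selfAdjoint.dense_domain
  rw [LinearPMap.isSelfAdjoint_def.1 d.selfAdjoint] at h
  exact h x y

theorem mem_A_domain_of_inner (d : DiracSystem H) {y w : H}
    (h : ∀ x : d.A.domain, ⟪w, (x : H)⟫_ℂ = ⟪y, d.A x⟫_ℂ) :
    ∃ hy : y ∈ d.A.domain, d.A ⟨y, hy⟩ = w := by
  have hA := LinearPMap.isSelfAdjoint_def.1 d.selfAdjoint
  have hmem : (y, w) ∈ d.A.graph := by
    rw [← hA, LinearPMap.adjoint_graph_eq_graph_adjoint d.selfAdjoint.dense_domain,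
      Submodule.mem_adjoint_iff]
    intro a b hab
    obtain ⟨x, rfl, rfl⟩ := (LinearPMap.mem_graph_iff _).1 hab
    have := congrArg (starRingEnd ℂ) (h x)
    rw [inner_conj_symm, inner_conj_symm] at this
    simp [this]
  obtain ⟨x, hx1, hx2⟩ := (LinearPMap.mem_graph_iff _).1 hmem
  simp only at hx1 hx2
  subst hx1
  exact ⟨x.2, hx2⟩

theorem eigenspace_orthogonal (d : DiracSystem H) {r s : ℝ} (hrs : r ≠ s) {x y : H}
    (hx : x ∈ d.eigenspace r) (hy : y ∈ d.eigenspace s) : ⟪x, y⟫_ℂ = 0 := by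
  obtain ⟨hx, hx'⟩ := d.mem_eigenspace_iff.1 hx
  obtain ⟨hy, hy'⟩ := d.mem_eigenspace_iff.1 hy
  have h := d.A_inner ⟨x, hx⟩ ⟨y, hy⟩
  rw [hx', hy', inner_smul_left, inner_smul_right, Complex.conj_ofReal] at h
  have h2 : ((r : ℂ) - s) * ⟪x, y⟫_ℂ = 0 := by rw [sub_mul, h, sub_self]
  rcases mul_eq_zero.1 h2 with h3 | h3
  · exact absurd (by exact_mod_cast sub_eq_zero.1 h3) hrs
  · exact h3

theorem γ_inner (d : DiracSystem H) (x y : H) : ⟪d.γ x, y⟫_ℂ = -⟪x, d.γ y⟫_ℂ := by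
  rw [← ContinuousLinearMap.adjoint_inner_right, d.γ_adjoint]
  simp

theorem γ_inner_γ (d : DiracSystem H) (x y : H) : ⟪d.γ x, d.γ y⟫_ℂ = ⟪x, y⟫_ℂ := by
  rw [γ_inner, d.γ_sq]
  simp

theorem norm_γ (d : DiracSystem H) (x : H) : ‖d.γ x‖ = ‖x‖ := by
  rw [@norm_eq_sqrt_re_inner ℂ, @norm_eq_sqrt_re_inner ℂ, γ_inner_γ]

theorem γ_mem_eigenspace (d : DiracSystem H) {r : ℝ} {x : H} (hx : x ∈ d.eigenspace r) :
    d.γ x ∈ d.eigenspace (-r) := by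
  obtain ⟨hx, hx'⟩ := d.mem_eigenspace_iff.1 hx
  refine d.mem_eigenspace_iff.2 ⟨d.γ_domain x hx, ?_⟩
  have := d.γ_anticomm ⟨x, hx⟩
  rw [hx', map_smul] at this
  rw [eq_neg_of_add_eq_zero_left this]
  simp

/-- Every vector is of the form `y + A² y`. -/
theorem exists_add_A_sq (d : DiracSystem H) :
    ∃ T : H →L[ℂ] H, IsCompactOperator T ∧
      ∀ x, ∃ (h : T x ∈ d.A.domain) (h' : d.A ⟨T x, h⟩ ∈ d.A.domain),
        T x + d.A ⟨d.A ⟨T x, h⟩, h'⟩ = x := by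
  -- The `ℓ²` product norm makes `H × H` a Hilbert space. `T x` will be the first component of the
  -- orthogonal projection of `(x, 0)` onto the graph of `A`; it is compact because it factors
  -- through the embedding of the graph.
  set e := WithLp.prodContinuousLinearEquiv 2 ℂ H H
  set G : Submodule ℂ (WithLp 2 (H × H)) := d.A.graph.comap (e : WithLp 2 (H × H) →ₗ[ℂ] H × H)
  have hG : IsClosed (G : Set (WithLp 2 (H × H))) :=
    (d.selfAdjoint.isClosed : IsClosed (d.A.graph : Set (H × H))).preimage e.continuous
  have : CompleteSpace G := hG.completeSpace_coe
  let P : H →L[ℂ] H × H := (e : WithLp 2 (H × H) →L[ℂ] H × H) ∘L G.starProjection ∘L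
    (e.symm : H × H →L[ℂ] WithLp 2 (H × H)) ∘L ContinuousLinearMap.inl ℂ H H
  have hP : ∀ x, P x ∈ d.A.graph := fun x =>
    G.starProjection_apply_mem (e.symm (x, 0))
  refine ⟨ContinuousLinearMap.fst ℂ H H ∘L P,
    d.compactEmbedding.comp_clm (P.codRestrict d.A.graph hP), fun x => ?_⟩
  obtain ⟨y, hy1, hy2⟩ := (LinearPMap.mem_graph_iff _).1 (hP x)
  -- Orthogonality of `(x, 0) - (y, A y)` to the graph says that `A y` lies in the domain of the
  -- adjoint, with image `x - y`.
  have horth : ∀ z : d.A.domain, ⟪x - y, (z : H)⟫_ℂ = ⟪d.A y, d.A z⟫_ℂ := by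
    intro z
    have hz : e.symm ((z : H), d.A z) ∈ G := by
      change e (e.symm ((z : H), d.A z)) ∈ d.A.graph
      rw [ContinuousLinearEquiv.apply_symm_apply]
      exact d.A.mem_graph z
    have h := G.starProjection_inner_eq_zero (e.symm (x, 0)) _ hz
    have hv : G.starProjection (e.symm (x, 0)) = e.symm ((y : H), d.A y) := by
      apply e.injective
      rw [ContinuousLinearEquiv.apply_symm_apply]
      exact Prod.ext hy1.symm hy2.symm
    rw [hv, ← map_sub, WithLp.prod_inner_apply] at h
    change ⟪x - y, (z : H)⟫_ℂ + ⟪0 - d.A y, d.A z⟫_ℂ = 0 at h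
    rw [zero_sub, inner_neg_left] at h
    exact eq_of_sub_eq_zero (by rw [sub_eq_add_neg]; exact h)
  obtain ⟨h1, h2⟩ := d.mem_A_domain_of_inner horth
  have hTx : (ContinuousLinearMap.fst ℂ H H ∘L P) x = y := hy1.symm
  have hdom : (ContinuousLinearMap.fst ℂ H H ∘L P) x ∈ d.A.domain := hTx ▸ y.2
  have hyy : (⟨_, hdom⟩ : d.A.domain) = y := Subtype.ext hTx
  refine ⟨hdom, by rw [hyy]; exact h1, ?_⟩
  simp only [h2, hTx]
  abel

/-- The eigenvectors of `A` are total in `H`. -/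
theorem eq_zero_of_forall_eigenspace (d : DiracSystem H) {y : H}
    (hy : ∀ r : ℝ, ∀ x ∈ d.eigenspace r, ⟪x, y⟫_ℂ = 0) : y = 0 := by
  obtain ⟨T, hT, hTA⟩ := d.exists_add_A_sq
  choose h1 h2 h3 using hTA
  have hinner : ∀ u v, ⟪T u, v⟫_ℂ = ⟪T u, T v⟫_ℂ + ⟪d.A ⟨T u, h1 u⟩, d.A ⟨T v, h1 v⟩⟫_ℂ := by
    intro u v
    conv_lhs => rw [← h3 v]
    rw [inner_add_right, ← d.A_inner ⟨T u, h1 u⟩]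
  have hsymm : (T : H →ₗ[ℂ] H).IsSymmetric := by
    intro u v
    change ⟪T u, v⟫_ℂ = ⟪u, T v⟫_ℂ
    rw [← inner_conj_symm u, hinner u v, hinner v u, map_add, inner_conj_symm, inner_conj_symm]
  -- Spectral theorem for the compact symmetric `T = (1 + A²)⁻¹`; it remains to split each
  -- eigenvector of `T` into eigenvectors of `A`.
  have htot := T.orthogonalComplement_iSup_eigenspaces_eq_bot hT hsymm
  have hmem : y ∈ (⨆ μ, Module.End.eigenspace (T : H →ₗ[ℂ] H) μ)ᗮ := by
    rw [← Submodule.iInf_orthogonal, Submodule.mem_iInf]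
    intro μ
    rw [Submodule.mem_orthogonal]
    intro x hx
    have hx : T x = μ • x := Module.End.mem_eigenspace_iff.1 hx
    by_cases hx0 : x = 0
    · simp [hx0]
    have hμ : μ ≠ 0 := by
      rintro rfl
      rw [zero_smul] at hx
      apply hx0
      have e1 : (⟨T x, h1 x⟩ : d.A.domain) = 0 := Subtype.ext hx
      have e2 : (⟨d.A ⟨T x, h1 x⟩, h2 x⟩ : d.A.domain) = 0 := by
        apply Subtype.ext; simp [e1, d.A.map_zero]
      rw [← h3 x, e2, d.A.map_zero, hx, add_zero]
    have hxd : x ∈ d.A.domain := by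
      have := d.A.domain.smul_mem μ⁻¹ (h1 x)
      rwa [hx, smul_smul, inv_mul_cancel₀ hμ, one_smul] at this
    have hAT : d.A ⟨T x, h1 x⟩ = μ • d.A ⟨x, hxd⟩ := by
      rw [← d.A.map_smul]
      congr 1
      exact Subtype.ext hx
    have hAx : d.A ⟨x, hxd⟩ ∈ d.A.domain := by
      have := d.A.domain.smul_mem μ⁻¹ (h2 x)
      rwa [hAT, smul_smul, inv_mul_cancel₀ hμ, one_smul] at this
    obtain ⟨w, hw⟩ : ∃ w, w = d.A ⟨x, hxd⟩ := ⟨_, rfl⟩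
    have hwd : w ∈ d.A.domain := hw ▸ hAx
    have hAA : x = μ • x + μ • d.A ⟨w, hwd⟩ := by
      have e1 : (⟨d.A ⟨T x, h1 x⟩, h2 x⟩ : d.A.domain) = μ • ⟨w, hwd⟩ :=
        Subtype.ext (hAT.trans (congrArg (fun v => μ • v) hw.symm))
      have e2 := h3 x
      rw [e1, d.A.map_smul] at e2
      conv_lhs => rw [← e2, hx]
    have hAw : d.A ⟨w, hwd⟩ = (μ⁻¹ - 1) • x := by
      have := congrArg (fun v => μ⁻¹ • v) hAA
      simp only [smul_add, smul_smul, inv_mul_cancel₀ hμ, one_smul] at this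
      rw [sub_smul, one_smul, this]
      abel
    have hsq : ⟪w, w⟫_ℂ = (μ⁻¹ - 1) * ⟪x, x⟫_ℂ := by
      have := d.A_inner ⟨x, hxd⟩ ⟨w, hwd⟩
      rw [← hw, hAw, inner_smul_right] at this
      exact this
    -- With `w = A x`, `A² x = (μ⁻¹ - 1) x` gives `‖w‖² = (μ⁻¹ - 1) ‖x‖²`, so this eigenvalue of
    -- `A²` has a real square root.
    obtain ⟨m, hm⟩ : ∃ m : ℝ, (m : ℂ) ^ 2 = μ⁻¹ - 1 := by
      refine ⟨‖w‖ / ‖x‖, ?_⟩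
      have hx0' : (‖x‖ : ℂ) ≠ 0 := by simpa using hx0
      have hsq' : (‖w‖ : ℂ) ^ 2 = (μ⁻¹ - 1) * (‖x‖ : ℂ) ^ 2 := by
        rw [inner_self_eq_norm_sq_to_K, inner_self_eq_norm_sq_to_K] at hsq
        exact hsq
      push_cast
      rw [div_pow]
      rw [hsq', mul_div_assoc, div_self (pow_ne_zero 2 hx0'), mul_one]
    by_cases hm0 : m = 0
    · have hw0 : w = 0 := by
        rw [← inner_self_eq_zero (𝕜 := ℂ), hsq, ← hm, hm0]
        simp
      refine hy 0 x (d.mem_eigenspace_iff.2 ⟨hxd, ?_⟩)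
      rw [← hw, hw0]
      simp
    -- `(A - k)(A + k) x = 0` for `k = ± m`, and the difference of the two eigenvectors `± m x + A
    -- x` is `2 m x`.
    · have hplus : ∀ k : ℝ, k ^ 2 = m ^ 2 → (k : ℂ) • x + w ∈ d.eigenspace k := by
        intro k hk
        refine d.mem_eigenspace_iff.2
          ⟨d.A.domain.add_mem (d.A.domain.smul_mem _ hxd) hwd, ?_⟩
        have : d.A ⟨(k : ℂ) • x + w, d.A.domain.add_mem (d.A.domain.smul_mem _ hxd) hwd⟩ =
            (k : ℂ) • d.A ⟨x, hxd⟩ + d.A ⟨w, hwd⟩ := by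
          rw [← d.A.map_smul, ← d.A.map_add]
          rfl
        rw [this, ← hw, hAw, ← hm, smul_add, smul_smul, add_comm, ← sq]
        congr 2
        exact_mod_cast hk.symm
      have e1 := hy m _ (hplus m rfl)
      have e2 := hy (-m) _ (hplus (-m) (by ring))
      rw [inner_add_left, inner_smul_left, Complex.conj_ofReal] at e1 e2
      have e3 : (2 * m : ℂ) * ⟪x, y⟫_ℂ = 0 := by
        push_cast at e2
        linear_combination e1 - e2
      refine (mul_eq_zero.1 e3).resolve_left ?_
      simpa using hm0
  rw [htot] at hmem
  exact (Submodule.mem_bot ℂ).1 hmem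

/-- A vector field which is orthogonal to every eigenvector at almost every time vanishes. -/
theorem ae_eq_zero_of_forall_eigenspace [TopologicalSpace.SeparableSpace H] (d : DiracSystem H)
    {μ : Measure ℝ} {f : ℝ → H}
    (hf : ∀ r : ℝ, ∀ x ∈ d.eigenspace r, ∀ᵐ t ∂μ, ⟪x, f t⟫_ℂ = 0) : ∀ᵐ t ∂μ, f t = 0 := by
  set Y : Set H := ⋃ r, (d.eigenspace r : Set H)
  -- The exceptional null set depends on the eigenvector; separability allows a countable dense set
  -- of eigenvectors, hence one common null set.
  obtain ⟨C, hCY, hC, hYC⟩ :=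
    (TopologicalSpace.IsSeparable.of_separableSpace Y).exists_countable_dense_subset
  have h1 : ∀ᵐ t ∂μ, ∀ x ∈ C, ⟪x, f t⟫_ℂ = 0 := by
    rw [ae_ball_iff hC]
    intro x hx
    obtain ⟨r, hr⟩ := mem_iUnion.1 (hCY hx)
    exact hf r x hr
  filter_upwards [h1] with t ht
  refine d.eq_zero_of_forall_eigenspace fun r x hx => ?_
  have hcl : IsClosed {x : H | ⟪x, f t⟫_ℂ = 0} :=
    isClosed_eq (by fun_prop) continuous_const
  exact closure_minimal ht hcl (hYC (mem_iUnion.2 ⟨r, hx⟩))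

end DiracSystem

/-! ### Scalar test functions on the half-line -/

/-- A real Lipschitz function `φ` with compact support in `[0, ∞)`, and its derivative `φ'`. -/
structure IsTestFunction (φ φ' : ℝ → ℝ) : Prop where
  lipschitz : ∀ T : ℝ, ∃ K : NNReal, LipschitzOnWith K φ (Icc 0 T)
  compactSupport : ∃ T : ℝ, ∀ t : ℝ, T ≤ t → φ t = 0
  deriv : ∀ᵐ t ∂halfLine, HasDerivWithinAt φ (φ' t) (Ici 0) t
  memLp : MemLp φ 2 halfLine
  memLp_deriv : MemLp φ' 2 halfLine

theorem IsTestFunction.sub_mul {φ φ' κ κ' : ℝ → ℝ} (hφ : IsTestFunction φ φ')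
    (hκ : IsTestFunction κ κ') (c : ℝ) :
    IsTestFunction (fun t => φ t - c * κ t) (fun t => φ' t - c * κ' t) where
  lipschitz T := by
    obtain ⟨K, hK⟩ := hφ.lipschitz T
    obtain ⟨L, hL⟩ := hκ.lipschitz T
    exact ⟨_, hK.sub ((lipschitzWith_smul c).comp_lipschitzOnWith hL)⟩
  compactSupport := by
    obtain ⟨T, hT⟩ := hφ.compactSupport
    obtain ⟨S, hS⟩ := hκ.compactSupport
    exact ⟨max T S, fun t ht => by
      simp [hT t ((le_max_left _ _).trans ht), hS t ((le_max_right _ _).trans ht)]⟩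
  deriv := by
    filter_upwards [hφ.deriv, hκ.deriv] with t h1 h2
    exact h1.sub (h2.const_mul c)
  memLp := hφ.memLp.sub (hκ.memLp.const_mul c)
  memLp_deriv := hφ.memLp_deriv.sub (hκ.memLp_deriv.const_mul c)

theorem memLp_halfLine_of_bounded {f : ℝ → ℝ} (hf : AEStronglyMeasurable f halfLine)
    {C T : ℝ} (hC : ∀ t, 0 ≤ t → |f t| ≤ C) (hT : ∀ t, T ≤ t → f t = 0) : MemLp f 2 halfLine := by
  have h : MemLp ((Icc 0 T).indicator fun _ : ℝ => C) 2 halfLine :=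
    memLp_indicator_const 2 measurableSet_Icc C (Or.inr (by
      refine ((Measure.restrict_apply_le _ _).trans_lt ?_).ne
      simp))
  refine h.of_le hf ?_
  filter_upwards [ae_restrict_mem measurableSet_Ici] with t ht
  by_cases h : t ≤ T
  · rw [indicator_of_mem (show t ∈ Icc 0 T from ⟨ht, h⟩), Real.norm_eq_abs, Real.norm_eq_abs]
    exact (hC t ht).trans (le_abs_self C)
  · rw [hT t (not_le.1 h).le]
    simp

/-- The function that is `1` on `[0, T]`, `0` on `[T + ε, ∞)` and affine in between. -/
def trapezoid (T ε t : ℝ) : ℝ := max 0 (min 1 (1 - (t - T) / ε))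

theorem trapezoid_of_le {T ε t : ℝ} (hε : 0 < ε) (h : t ≤ T) : trapezoid T ε t = 1 := by
  have : (t - T) / ε ≤ 0 := div_nonpos_of_nonpos_of_nonneg (by linarith) hε.le
  rw [trapezoid, min_eq_left (by linarith), max_eq_right zero_le_one]

theorem trapezoid_of_ge {T ε t : ℝ} (hε : 0 < ε) (h : T + ε ≤ t) : trapezoid T ε t = 0 := by
  have : 1 ≤ (t - T) / ε := by rw [le_div_iff₀ hε]; linarith
  rw [trapezoid, max_eq_left]
  exact (min_le_right _ _).trans (by linarith)

theorem trapezoid_of_mem {T ε t : ℝ} (hε : 0 < ε) (h : t ∈ Icc T (T + ε)) :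
    trapezoid T ε t = 1 - (t - T) / ε := by
  have h1 : (t - T) / ε ≤ 1 := by rw [div_le_one hε]; linarith [h.2]
  have h2 : 0 ≤ (t - T) / ε := div_nonneg (by linarith [h.1]) hε.le
  rw [trapezoid, min_eq_right (by linarith), max_eq_right (by linarith)]

theorem abs_trapezoid_le (T ε t : ℝ) : |trapezoid T ε t| ≤ 1 := by
  rw [trapezoid, abs_of_nonneg (le_max_left _ _)]
  exact max_le zero_le_one (min_le_left _ _)

theorem isTestFunction_trapezoid {T ε : ℝ} (hε : 0 < ε) :
    IsTestFunction (trapezoid T ε) ((Ioc T (T + ε)).indicator fun _ => -ε⁻¹) where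
  lipschitz S := by
    have h : LipschitzWith _ fun t : ℝ => 1 - ε⁻¹ • (t - T) :=
      (LipschitzWith.const 1).sub ((lipschitzWith_smul ε⁻¹).comp
        (LipschitzWith.id.sub (LipschitzWith.const T)))
    have h2 := (h.const_min 1).const_max 0
    have h3 : (fun t => max 0 (min 1 (1 - ε⁻¹ • (t - T)))) = trapezoid T ε := by
      ext t
      simp [trapezoid, div_eq_inv_mul]
    rw [h3] at h2
    exact ⟨_, h2.lipschitzOnWith⟩
  compactSupport := ⟨T + ε, fun t ht => trapezoid_of_ge hε ht⟩
  deriv := by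
    have h0 : ∀ᵐ t ∂halfLine, t ≠ T := by
      refine ae_restrict_of_ae ?_
      simp [ae_iff]
    have h1 : ∀ᵐ t ∂halfLine, t ≠ T + ε := by
      refine ae_restrict_of_ae ?_
      simp [ae_iff]
    filter_upwards [h0, h1] with t h0 h1
    refine HasDerivAt.hasDerivWithinAt ?_
    rcases lt_or_gt_of_ne h0 with h | h
    · rw [indicator_of_notMem (by simp [h.le])]
      refine (hasDerivAt_const t (1 : ℝ)).congr_of_eventuallyEq ?_
      filter_upwards [Iio_mem_nhds h] with x hx using trapezoid_of_le hε (le_of_lt hx)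
    rcases lt_or_gt_of_ne h1 with h' | h'
    · rw [indicator_of_mem (show t ∈ Ioc T (T + ε) from ⟨h, h'.le⟩)]
      have : HasDerivAt (fun x : ℝ => 1 - (x - T) / ε) (-ε⁻¹) t := by
        simpa using (((hasDerivAt_id t).sub_const T).div_const ε).const_sub 1
      refine this.congr_of_eventuallyEq ?_
      filter_upwards [Ioo_mem_nhds h h'] with x hx
        using trapezoid_of_mem hε (Ioo_subset_Icc_self hx)
    · rw [indicator_of_notMem (by simp [h'])]
      refine (hasDerivAt_const t (0 : ℝ)).congr_of_eventuallyEq ?_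
      filter_upwards [Ioi_mem_nhds h'] with x hx using trapezoid_of_ge hε (le_of_lt hx)
  memLp := by
    refine memLp_halfLine_of_bounded (C := 1) (T := T + ε) ?_ (fun t _ => abs_trapezoid_le T ε t)
      (fun t ht => trapezoid_of_ge hε ht)
    refine Continuous.aestronglyMeasurable ?_
    unfold trapezoid
    fun_prop
  memLp_deriv := by
    refine memLp_indicator_const 2 measurableSet_Ioc _ (Or.inr ?_)
    refine ((Measure.restrict_apply_le _ _).trans_lt ?_).ne
    simp

/-! ### Functions on the half-line with a weak derivative -/

theorem intervalIntegrable_of_memLp_halfLine {b : ℝ → ℂ} (hb : MemLp b 2 halfLine) {x y : ℝ}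
    (hx : 0 ≤ x) (hy : 0 ≤ y) : IntervalIntegrable b volume x y := by
  rw [intervalIntegrable_iff]
  have hsub : uIoc x y ⊆ Ici 0 := fun t ht => (le_min hx hy).trans ht.1.le
  have h := hb.restrict (uIoc x y)
  rw [Measure.restrict_restrict_of_subset hsub] at h
  have : IsFiniteMeasure (volume.restrict (uIoc x y)) := ⟨by simp [uIoc]⟩
  exact h.integrable (by norm_num)

theorem integral_test_sub_mul {a b : ℝ → ℂ} (ha : MemLp a 2 halfLine) (hb : MemLp b 2 halfLine)
    {φ φ' κ κ' : ℝ → ℝ} (hφ : IsTestFunction φ φ') (hκ : IsTestFunction κ κ') (c : ℝ) :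
    ∫ t, (((φ' t - c * κ' t : ℝ) : ℂ) * a t + ((φ t - c * κ t : ℝ) : ℂ) * b t) ∂halfLine =
      (∫ t, ((φ' t : ℂ) * a t + (φ t : ℂ) * b t) ∂halfLine) -
        c * ∫ t, ((κ' t : ℂ) * a t + (κ t : ℂ) * b t) ∂halfLine := by
  have hi : ∀ {ψ : ℝ → ℝ} {f : ℝ → ℂ}, MemLp ψ 2 halfLine → MemLp f 2 halfLine →
      Integrable (fun t => (ψ t : ℂ) * f t) halfLine := fun hψ hf =>
    MemLp.integrable_mul hψ.ofReal hf
  rw [← integral_const_mul, ← integral_sub]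
  · refine integral_congr_ae (Filter.Eventually.of_forall fun t => ?_)
    simp only
    push_cast
    ring
  · exact (hi hφ.memLp_deriv ha).add (hi hφ.memLp hb)
  · exact ((hi hκ.memLp_deriv ha).add (hi hκ.memLp hb)).const_mul _

/-- If `a' = b` weakly on `(0, ∞)`, then `a` is a primitive of `b`, and its value at `0` can be
computed with any test function. -/
theorem ae_eq_integral_of_weak_deriv {a b : ℝ → ℂ} (ha : MemLp a 2 halfLine)
    (hb : MemLp b 2 halfLine) {κ κ' : ℝ → ℝ} (hκ : IsTestFunction κ κ') (hκ0 : κ 0 = 1)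
    (hab : ∀ φ φ' : ℝ → ℝ, IsTestFunction φ φ' → φ 0 = 0 →
      ∫ t, ((φ' t : ℂ) * a t + (φ t : ℂ) * b t) ∂halfLine = 0) :
    ∀ᵐ t ∂halfLine, a t = (∫ x in (0 : ℝ)..t, b x) -
      ∫ t, ((κ' t : ℂ) * a t + (κ t : ℂ) * b t) ∂halfLine := by
  set ℓ := ∫ t, ((κ' t : ℂ) * a t + (κ t : ℂ) * b t) ∂halfLine
  -- The difference of two test functions with value `1` at `0` vanishes at `0`, so `ℓ` does not
  -- depend on the choice of `κ`. It is now computed with trapezoids dropping from `1` to `0` on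
  -- `[T, T + ε]`, as `ε → 0`.
  have htest : ∀ φ φ' : ℝ → ℝ, IsTestFunction φ φ' → φ 0 = 1 →
      ∫ t, ((φ' t : ℂ) * a t + (φ t : ℂ) * b t) ∂halfLine = ℓ := by
    intro φ φ' hφ hφ0
    have h := hab _ _ (hφ.sub_mul hκ 1) (by simp [hφ0, hκ0])
    rw [integral_test_sub_mul ha hb hφ hκ] at h
    simpa using sub_eq_zero.1 h
  set a₀ : ℝ → ℂ := (Ici 0).indicator a
  have ha₀ : LocallyIntegrable a₀ volume := by
    have : MemLp a₀ 2 volume := (memLp_indicator_iff_restrict measurableSet_Ici).2 ha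
    exact this.locallyIntegrable (by norm_num)
  have hLeb := LocallyIntegrable.ae_hasDerivAt_integral ha₀
  filter_upwards [ae_restrict_of_ae hLeb, ae_restrict_mem measurableSet_Ici] with T hT hT0
  have hT0 : 0 ≤ T := hT0
  set ε : ℕ → ℝ := fun n => 1 / ((n : ℝ) + 1)
  have hε : ∀ n, 0 < ε n := fun n => Nat.one_div_pos_of_nat
  have hεlim : Filter.Tendsto ε Filter.atTop (nhds 0) := tendsto_one_div_add_atTop_nhds_zero_nat
  -- The derivative of the trapezoid averages `a` over `(T, T + ε]`; at a Lebesgue point the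
  -- averages tend to `a T`.
  have h1 : Filter.Tendsto (fun n => -∫ t,
      (((Ioc T (T + ε n)).indicator (fun _ => -(ε n)⁻¹) t : ℝ) : ℂ) * a t ∂halfLine)
      Filter.atTop (nhds (a T)) := by
    have h := (hasDerivAt_iff_tendsto_slope_zero.1 (hT T)).comp
      (tendsto_nhdsWithin_iff.2 ⟨hεlim, Filter.Eventually.of_forall fun n => (hε n).ne'⟩)
    rw [show a₀ T = a T from indicator_of_mem hT0 a] at h
    refine h.congr fun n => ?_
    have hn := hε n
    simp only [Function.comp, intervalIntegral.integral_same, sub_zero]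
    rw [intervalIntegral.integral_of_le (by linarith)]
    have e1 : ∀ t, (((Ioc T (T + ε n)).indicator (fun _ => -(ε n)⁻¹) t : ℝ) : ℂ) * a t =
        (Ioc T (T + ε n)).indicator (fun t => (-(ε n)⁻¹ : ℂ) * a t) t := by
      intro t
      by_cases h : t ∈ Ioc T (T + ε n) <;> simp [h]
    simp_rw [e1]
    have hsub : Ioc T (T + ε n) ⊆ Ici 0 := fun t ht => hT0.trans ht.1.le
    rw [integral_indicator measurableSet_Ioc, Measure.restrict_restrict_of_subset hsub,
      integral_const_mul, setIntegral_congr_fun measurableSet_Ioc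
        (fun t ht => indicator_of_mem (hsub ht) a)]
    simp
  have h2 : Filter.Tendsto (fun n => ∫ t, ((trapezoid T (ε n) t : ℝ) : ℂ) * b t ∂halfLine)
      Filter.atTop (nhds (∫ x in (0 : ℝ)..T, b x)) := by
    have e : ∫ x in (0 : ℝ)..T, b x = ∫ x, (Iic T).indicator b x ∂halfLine := by
      rw [intervalIntegral.integral_of_le hT0, integral_indicator measurableSet_Iic,
        Measure.restrict_restrict measurableSet_Iic, inter_comm, Ici_inter_Iic,
        integral_Icc_eq_integral_Ioc]
    rw [e]
    refine tendsto_integral_of_dominated_convergence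
      (fun t => ‖(Icc 0 (T + 1)).indicator b t‖) (fun n => ?_) ?_ (fun n => ?_) ?_
    · exact (isTestFunction_trapezoid (T := T) (hε n)).memLp.ofReal.aestronglyMeasurable.mul
        hb.aestronglyMeasurable
    · refine Integrable.norm ?_
      rw [integrable_indicator_iff measurableSet_Icc]
      have hsub : Icc 0 (T + 1) ⊆ Ici (0 : ℝ) := Icc_subset_Ici_self
      rw [IntegrableOn, Measure.restrict_restrict_of_subset hsub]
      have := intervalIntegrable_of_memLp_halfLine hb le_rfl (show 0 ≤ T + 1 by linarith)
      rwa [intervalIntegrable_iff_integrableOn_Icc_of_le (by linarith)] at this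
    · filter_upwards [ae_restrict_mem measurableSet_Ici] with t ht
      by_cases h : t ≤ T + 1
      · rw [indicator_of_mem (show t ∈ Icc 0 (T + 1) from ⟨ht, h⟩), norm_mul, Complex.norm_real]
        exact mul_le_of_le_one_left (norm_nonneg _) (abs_trapezoid_le _ _ _)
      · have h3 : ε n ≤ 1 := by
          simp only [ε]
          rw [div_le_one (by positivity)]
          have : (0 : ℝ) ≤ n := n.cast_nonneg
          linarith
        rw [trapezoid_of_ge (hε n) (by linarith [not_le.1 h])]
        simp
    · refine Filter.Eventually.of_forall fun t => ?_
      by_cases h : t ≤ T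
      · rw [indicator_of_mem (show t ∈ Iic T from h)]
        refine tendsto_const_nhds.congr fun n => ?_
        rw [trapezoid_of_le (hε n) h]
        simp
      · rw [indicator_of_notMem (by simpa using h)]
        refine tendsto_const_nhds.congr' ?_
        have h3 : 0 < t - T := by linarith [not_le.1 h]
        filter_upwards [hεlim.eventually (Iio_mem_nhds h3)] with n hn
        rw [trapezoid_of_ge (hε n) (by linarith [show ε n < t - T from hn])]
        simp
  have h3 : ∀ n, (∫ t, ((trapezoid T (ε n) t : ℝ) : ℂ) * b t ∂halfLine) -
      (-∫ t, (((Ioc T (T + ε n)).indicator (fun _ => -(ε n)⁻¹) t : ℝ) : ℂ) * a t ∂halfLine)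
        = ℓ := by
    intro n
    have hn := isTestFunction_trapezoid (T := T) (hε n)
    rw [← htest _ _ hn (trapezoid_of_le (hε n) hT0), integral_add, sub_neg_eq_add, add_comm]
    · exact MemLp.integrable_mul hn.memLp_deriv.ofReal ha
    · exact MemLp.integrable_mul hn.memLp.ofReal hb
  have h4 := tendsto_nhds_unique ((h2.sub h1).congr h3) tendsto_const_nhds
  rw [← h4]
  ring

theorem continuousOn_primitive_halfLine {b : ℝ → ℂ} (hb : MemLp b 2 halfLine) :
    ContinuousOn (fun t => ∫ x in (0 : ℝ)..t, b x) (Ici 0) := by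
  intro t ht
  have ht : 0 ≤ t := ht
  have h := intervalIntegral.continuousOn_primitive_interval (μ := volume) (f := b) (a := 0)
    (b := t + 1) (by
      have := intervalIntegrable_of_memLp_halfLine hb le_rfl (show 0 ≤ t + 1 by linarith)
      rwa [intervalIntegrable_iff_integrableOn_Icc_of_le (by linarith),
        ← uIcc_of_le (by linarith)] at this)
  rw [uIcc_of_le (by linarith)] at h
  refine (h t ⟨ht, by linarith⟩).mono_of_mem_nhdsWithin ?_
  rw [← Ici_inter_Iic]
  exact Filter.inter_mem self_mem_nhdsWithin
    (mem_nhdsWithin_of_mem_nhds (Iic_mem_nhds (by linarith)))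

theorem eq_of_ae_eq_of_continuousWithinAt_zero {f g : ℝ → ℂ}
    (h : ∀ᵐ t ∂halfLine, f t = g t) (hf : ContinuousWithinAt f (Ici 0) 0)
    (hg : ContinuousWithinAt g (Ici 0) 0) : f 0 = g 0 := by
  have hfreq : ∃ᶠ t in nhdsWithin (0 : ℝ) (Ici 0), f t = g t := by
    rw [Filter.frequently_iff]
    intro U hU
    obtain ⟨δ, hδ, hU⟩ := mem_nhdsGE_iff_exists_Ico_subset.1 hU
    by_contra hcon
    push Not at hcon
    have h0 : volume (Ico (0 : ℝ) δ) = 0 := by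
      refine measure_mono_null (fun t ht => ?_)
        ((ae_iff (μ := volume)).1 ((ae_restrict_iff' measurableSet_Ici).1 h))
      simp only [mem_ofPred_eq, Classical.not_imp]
      exact ⟨ht.1, hcon t (hU ht)⟩
    have : δ ≤ 0 := by simpa using h0
    exact absurd hδ (not_lt.2 this)
  have hlim : Filter.Tendsto (fun t => f t - g t) (nhdsWithin 0 (Ici 0)) (nhds (f 0 - g 0)) :=
    Filter.Tendsto.sub hf hg
  by_contra hne
  have hev : ∀ᶠ t in nhdsWithin (0 : ℝ) (Ici 0), f t - g t ≠ 0 :=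
    hlim.eventually_ne (sub_ne_zero.2 hne)
  exact hfreq (hev.mono fun t ht h => ht (sub_eq_zero.2 h))

/-- The value at `0` of a weakly differentiable function which is continuous at `0`. -/
theorem integral_test_eq_neg_value_zero {a b α : ℝ → ℂ} (ha : MemLp a 2 halfLine)
    (hb : MemLp b 2 halfLine) (haα : ∀ᵐ t ∂halfLine, a t = α t)
    (hα : ContinuousWithinAt α (Ici 0) 0) {κ κ' : ℝ → ℝ} (hκ : IsTestFunction κ κ')
    (hκ0 : κ 0 = 1)
    (hab : ∀ φ φ' : ℝ → ℝ, IsTestFunction φ φ' → φ 0 = 0 →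
      ∫ t, ((φ' t : ℂ) * a t + (φ t : ℂ) * b t) ∂halfLine = 0) :
    ∫ t, ((κ' t : ℂ) * a t + (κ t : ℂ) * b t) ∂halfLine = -α 0 := by
  have h := ae_eq_integral_of_weak_deriv ha hb hκ hκ0 hab
  set ℓ := ∫ t, ((κ' t : ℂ) * a t + (κ t : ℂ) * b t) ∂halfLine
  have h2 := eq_of_ae_eq_of_continuousWithinAt_zero (f := α)
    (g := fun t => (∫ x in (0 : ℝ)..t, b x) - ℓ)
    (by filter_upwards [h, haα] with t h1 h2; rw [← h2, h1]) hα
    ((continuousOn_primitive_halfLine hb 0 self_mem_Ici).sub continuousWithinAt_const)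
  simp [h2]

/-- Test functions vanishing at `0` separate the points of `L²`. -/
theorem ae_eq_zero_of_forall_test {b : ℝ → ℂ} (hb : MemLp b 2 halfLine)
    (h : ∀ φ φ' : ℝ → ℝ, IsTestFunction φ φ' → φ 0 = 0 →
      ∫ t, (φ t : ℂ) * b t ∂halfLine = 0) : ∀ᵐ t ∂halfLine, b t = 0 := by
  -- The hypothesis says that `b` is the weak derivative of `0`. So the primitive of `b` is constant
  -- on `(0, ∞)`, and `b` vanishes at Lebesgue points.
  have h1 := ae_eq_integral_of_weak_deriv (a := fun _ => 0) MemLp.zero hb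
    (isTestFunction_trapezoid (T := 0) one_pos) (trapezoid_of_le one_pos le_rfl)
    (by simpa using h)
  set ℓ := ∫ t, ((((Ioc 0 (0 + 1)).indicator (fun _ => -1⁻¹) t : ℝ) : ℂ) * 0 +
    ((trapezoid 0 1 t : ℝ) : ℂ) * b t) ∂halfLine
  have h2 : EqOn (fun t => ∫ x in (0 : ℝ)..t, b x) (fun _ => ℓ) (Ioi 0) := by
    refine Measure.eqOn_open_of_ae_eq (μ := (volume : Measure ℝ)) ?_ isOpen_Ioi
      ((continuousOn_primitive_halfLine hb).mono Ioi_subset_Ici_self) continuousOn_const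
    refine ae_restrict_of_ae_restrict_of_subset Ioi_subset_Ici_self ?_
    filter_upwards [h1] with t ht using (sub_eq_zero.1 ht.symm)
  set b₀ : ℝ → ℂ := (Ici 0).indicator b
  have hb₀ : LocallyIntegrable b₀ volume := by
    have : MemLp b₀ 2 volume := (memLp_indicator_iff_restrict measurableSet_Ici).2 hb
    exact this.locallyIntegrable (by norm_num)
  have h0 : ∀ᵐ t ∂halfLine, t ≠ 0 := ae_restrict_of_ae (by simp [ae_iff])
  filter_upwards [ae_restrict_of_ae (LocallyIntegrable.ae_hasDerivAt_integral hb₀), ae_restrict_mem measurableSet_Ici,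
    h0] with t ht ht0 hne
  have htpos : 0 < t := lt_of_le_of_ne ht0 (Ne.symm hne)
  have h3 := ht 0
  rw [show b₀ t = b t from indicator_of_mem ht0 b] at h3
  refine h3.unique ((hasDerivAt_const t ℓ).congr_of_eventuallyEq ?_)
  filter_upwards [Ioi_mem_nhds htpos] with x hx
  refine Eq.trans ?_ (h2 hx)
  refine intervalIntegral.integral_congr fun y hy => ?_
  rw [uIcc_of_le (le_of_lt hx)] at hy
  exact indicator_of_mem (show y ∈ Ici 0 from hy.1) b

/-! ### An exponentially decaying profile with compact support -/

/-- The function `(1 - t)₊ e^{-ct}`. -/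
def profile (c t : ℝ) : ℝ := max 0 ((1 - t) * Real.exp (-c * t))

/-- The almost everywhere defined derivative of `profile`. -/
def profileDeriv (c : ℝ) : ℝ → ℝ :=
  (Iio 1).indicator fun t => (-c * (1 - t) - 1) * Real.exp (-c * t)

@[simp]
theorem profile_zero (c : ℝ) : profile c 0 = 1 := by simp [profile]

theorem profile_of_le {c t : ℝ} (h : t ≤ 1) : profile c t = (1 - t) * Real.exp (-c * t) :=
  max_eq_right (mul_nonneg (by linarith) (Real.exp_pos _).le)

theorem profile_of_ge {c t : ℝ} (h : 1 ≤ t) : profile c t = 0 :=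
  max_eq_left (mul_nonpos_of_nonpos_of_nonneg (by linarith) (Real.exp_pos _).le)

theorem abs_profile_le {c t : ℝ} (ht : 0 ≤ t) : |profile c t| ≤ 1 * Real.exp (-c * t) := by
  rcases le_total t 1 with h | h
  · rw [profile_of_le h, abs_mul, Real.abs_exp]
    refine mul_le_mul_of_nonneg_right ?_ (Real.exp_pos _).le
    rw [abs_of_nonneg (by linarith)]
    linarith
  · rw [profile_of_ge h, abs_zero, one_mul]
    exact (Real.exp_pos _).le

/-- This is the coefficient of `D (profile ⊗ x)` for `x ∈ ker (A - r)`. Differentiating the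
exponential gives `-c`, so only `r - c` survives, and for `c = √(1 + r²)` it stays bounded as `r →
+∞`. The `1` is the slope of the cutoff `(1 - t)₊`. -/
theorem abs_profileDeriv_add_le {c t : ℝ} (r : ℝ) (ht : 0 ≤ t) :
    |profileDeriv c t + r * profile c t| ≤ (|r - c| + 1) * Real.exp (-c * t) := by
  have hK : 0 ≤ |r - c| + 1 := by positivity
  rcases lt_or_ge t 1 with h | h
  · rw [profileDeriv, indicator_of_mem (show t ∈ Iio 1 from h), profile_of_le h.le,
      show (-c * (1 - t) - 1) * Real.exp (-c * t) + r * ((1 - t) * Real.exp (-c * t)) =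
        ((r - c) * (1 - t) - 1) * Real.exp (-c * t) by ring, abs_mul, Real.abs_exp]
    refine mul_le_mul_of_nonneg_right ?_ (Real.exp_pos _).le
    refine (abs_sub _ _).trans ?_
    rw [abs_mul, abs_one, abs_of_nonneg (show 0 ≤ 1 - t by linarith)]
    have := mul_le_of_le_one_right (abs_nonneg (r - c)) (show 1 - t ≤ 1 by linarith)
    linarith
  · rw [profileDeriv, indicator_of_notMem (by simpa using h), profile_of_ge h]
    simp only [mul_zero, add_zero, abs_zero]
    exact mul_nonneg hK (Real.exp_pos _).le

theorem measurable_profileDeriv (c : ℝ) : Measurable (profileDeriv c) :=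
  Measurable.indicator (by fun_prop) measurableSet_Iio

theorem isTestFunction_profile {c : ℝ} (hc : 0 < c) :
    IsTestFunction (profile c) (profileDeriv c) where
  lipschitz T := by
    obtain ⟨K, hK⟩ := ContDiffOn.exists_lipschitzOnWith (n := 1) (s := Icc 0 T)
      (f := fun t : ℝ => (1 - t) * Real.exp (-c * t))
      (ContDiff.contDiffOn (by fun_prop)) one_ne_zero (convex_Icc 0 T) isCompact_Icc
    exact ⟨_, (LipschitzWith.id.const_max 0).comp_lipschitzOnWith hK⟩
  compactSupport := ⟨1, fun t ht => profile_of_ge ht⟩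
  deriv := by
    have h0 : ∀ᵐ t ∂halfLine, t ≠ 1 := ae_restrict_of_ae (by simp [ae_iff])
    filter_upwards [h0] with t h0
    refine HasDerivAt.hasDerivWithinAt ?_
    rcases lt_or_gt_of_ne h0 with h | h
    · rw [profileDeriv, indicator_of_mem (show t ∈ Iio 1 from h)]
      have h1 : HasDerivAt (fun t : ℝ => (1 - t) * Real.exp (-c * t))
          ((-c * (1 - t) - 1) * Real.exp (-c * t)) t := by
        have := ((hasDerivAt_id t).const_sub 1).mul ((hasDerivAt_id t).const_mul (-c)).exp
        convert! this using 1
        simp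
        ring
      refine h1.congr_of_eventuallyEq ?_
      filter_upwards [Iio_mem_nhds h] with x hx using profile_of_le (le_of_lt hx)
    · rw [profileDeriv, indicator_of_notMem (by simpa using h.le)]
      refine (hasDerivAt_const t (0 : ℝ)).congr_of_eventuallyEq ?_
      filter_upwards [Ioi_mem_nhds h] with x hx using profile_of_ge (le_of_lt hx)
  memLp := by
    refine memLp_halfLine_of_bounded (C := 1) (T := 1) ?_ (fun t ht => ?_)
      (fun t ht => profile_of_ge ht)
    · refine Continuous.aestronglyMeasurable ?_
      unfold profile
      fun_prop
    · refine (abs_profile_le ht).trans ?_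
      rw [one_mul, Real.exp_le_one_iff]
      nlinarith
  memLp_deriv := by
    refine memLp_halfLine_of_bounded (C := |0 - c| + 1) (T := 1)
      (measurable_profileDeriv c).aestronglyMeasurable (fun t ht => ?_)
      (fun t ht => indicator_of_notMem (by simpa using ht) _)
    have h := abs_profileDeriv_add_le (c := c) 0 ht
    rw [zero_mul, add_zero] at h
    refine h.trans (mul_le_of_le_one_right (by positivity) ?_)
    rw [Real.exp_le_one_iff]
    nlinarith

theorem integral_sq_le_of_abs_le_exp {ψ : ℝ → ℝ} {K c : ℝ} (hc : 0 < c)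
    (h : ∀ t, 0 ≤ t → |ψ t| ≤ K * Real.exp (-c * t)) :
    ∫ t, ψ t ^ 2 ∂halfLine ≤ K ^ 2 / c := by
  have hi : IntegrableOn (fun t : ℝ => K ^ 2 * Real.exp (-(2 * c) * t)) (Ici 0) := by
    rw [integrableOn_Ici_iff_integrableOn_Ioi]
    exact (integrableOn_exp_mul_Ioi (by linarith) 0).const_mul _
  calc ∫ t, ψ t ^ 2 ∂halfLine
      ≤ ∫ t, K ^ 2 * Real.exp (-(2 * c) * t) ∂halfLine := by
        refine integral_mono_of_nonneg (Filter.Eventually.of_forall fun t => sq_nonneg _) hi ?_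
        filter_upwards [ae_restrict_mem measurableSet_Ici] with t ht
        have h1 := pow_le_pow_left₀ (abs_nonneg _) (h t ht) 2
        rw [sq_abs, mul_pow, ← Real.exp_nat_mul] at h1
        convert! h1 using 3
        push_cast
        ring
    _ = K ^ 2 * (1 / (2 * c)) := by
        rw [integral_const_mul, integral_Ici_eq_integral_Ioi,
          integral_exp_mul_Ioi (by linarith) 0]
        simp
    _ ≤ K ^ 2 / c := by
        rw [div_eq_mul_one_div (K ^ 2) c]
        refine mul_le_mul_of_nonneg_left ?_ (sq_nonneg K)
        exact one_div_le_one_div_of_le hc (by linarith)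

/-! ### Two facts from real analysis -/

/-- Lipschitz functions are absolutely continuous, so the fundamental theorem of calculus applies on
`[0, T]`; beyond the support the derivative vanishes. -/
theorem integral_halfLine_deriv_real {f g : ℝ → ℝ}
    (hf : ∀ T : ℝ, ∃ K : NNReal, LipschitzOnWith K f (Icc 0 T))
    (hsupp : ∃ T : ℝ, ∀ t, T ≤ t → f t = 0)
    (hg : ∀ᵐ t ∂halfLine, HasDerivWithinAt f (g t) (Ici 0) t) :
    ∫ t, g t ∂halfLine = -f 0 := by
  obtain ⟨T₀, hT₀⟩ := hsupp
  set T := max T₀ 0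
  have hT : 0 ≤ T := le_max_right _ _
  have hTf : ∀ t, T ≤ t → f t = 0 := fun t ht => hT₀ t ((le_max_left _ _).trans ht)
  obtain ⟨K, hK⟩ := hf T
  have hac : AbsolutelyContinuousOnInterval f 0 T := by
    rw [← uIcc_of_le hT] at hK
    exact hK.absolutelyContinuousOnInterval
  have hne : ∀ a : ℝ, ∀ᵐ t ∂halfLine, t ≠ a := fun a => ae_restrict_of_ae (by simp [ae_iff])
  have hderiv : ∀ᵐ t ∂halfLine, HasDerivAt f (g t) t := by
    filter_upwards [hg, hne 0, ae_restrict_mem measurableSet_Ici] with t h1 h2 h3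
    exact h1.hasDerivAt (Ici_mem_nhds (lt_of_le_of_ne h3 (Ne.symm h2)))
  have h1 : ∫ t, g t ∂halfLine = ∫ t, (Iic T).indicator (deriv f) t ∂halfLine := by
    refine integral_congr_ae ?_
    filter_upwards [hderiv, hne T] with t h1 h2
    rcases lt_or_gt_of_ne h2 with h | h
    · rw [indicator_of_mem (show t ∈ Iic T from h.le), h1.deriv]
    · rw [indicator_of_notMem (by simpa using h)]
      refine h1.unique ((hasDerivAt_const t (0 : ℝ)).congr_of_eventuallyEq ?_)
      filter_upwards [Ioi_mem_nhds h] with x hx using hTf x (le_of_lt hx)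
  rw [h1, integral_indicator measurableSet_Iic, Measure.restrict_restrict measurableSet_Iic,
    inter_comm, Ici_inter_Iic, integral_Icc_eq_integral_Ioc,
    ← intervalIntegral.integral_of_le hT, hac.integral_deriv_eq_sub, hTf T le_rfl, zero_sub]

theorem integral_halfLine_deriv {f g : ℝ → ℂ}
    (hf : ∀ T : ℝ, ∃ K : NNReal, LipschitzOnWith K f (Icc 0 T))
    (hsupp : ∃ T : ℝ, ∀ t, T ≤ t → f t = 0)
    (hg : ∀ᵐ t ∂halfLine, HasDerivWithinAt f (g t) (Ici 0) t) (hgi : Integrable g halfLine) :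
    ∫ t, g t ∂halfLine = -f 0 := by
  have key : ∀ L : ℂ →L[ℝ] ℝ, L (∫ t, g t ∂halfLine) = -L (f 0) := by
    intro L
    rw [← L.integral_comp_comm hgi]
    refine integral_halfLine_deriv_real (f := fun t => L (f t)) (fun T => ?_) ?_ ?_
    · obtain ⟨K, hK⟩ := hf T
      exact ⟨_, L.lipschitz.comp_lipschitzOnWith hK⟩
    · obtain ⟨T, hT⟩ := hsupp
      exact ⟨T, fun t ht => by simp [hT t ht]⟩
    · filter_upwards [hg] with t ht
      exact L.hasFDerivAt.comp_hasDerivWithinAt t ht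
  refine Complex.ext ?_ ?_
  · simpa using key Complex.reCLM
  · simpa using key Complex.imCLM

/-- The system `a' = s a - w`, `w' = -s w - a` has no square integrable solution with
`a(0) = 0`. -/
theorem ae_eq_zero_of_hyperbolic_system {a w : ℝ → ℂ} (s : ℝ) (c : ℂ)
    (ha : MemLp a 2 halfLine) (hw : MemLp w 2 halfLine)
    (h1 : ∀ᵐ t ∂halfLine, a t = ∫ x in (0 : ℝ)..t, (s * a x - w x))
    (h2 : ∀ᵐ t ∂halfLine, w t = (∫ x in (0 : ℝ)..t, (-s * w x - a x)) + c) :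
    ∀ᵐ t ∂halfLine, a t = 0 ∧ w t = 0 := by
  have hb₁ : MemLp (fun x => s * a x - w x) 2 halfLine := (ha.const_mul (s : ℂ)).sub hw
  have hb₂ : MemLp (fun x => -s * w x - a x) 2 halfLine := (hw.const_mul (-s : ℂ)).sub ha
  set A : ℝ → ℂ := fun t => ∫ x in (0 : ℝ)..t, (s * a x - w x)
  set W : ℝ → ℂ := fun t => (∫ x in (0 : ℝ)..t, (-s * w x - a x)) + c
  have hA : ContinuousOn A (Ici 0) := continuousOn_primitive_halfLine hb₁
  have hW : ContinuousOn W (Ici 0) := (continuousOn_primitive_halfLine hb₂).add continuousOn_const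
  -- Replacing the integrands by continuous representatives makes the system hold classically at
  -- every `t > 0`.
  have hprim : ∀ {b B : ℝ → ℂ}, (∀ᵐ t ∂halfLine, b t = B t) → ContinuousOn B (Ici 0) →
      ∀ t, 0 < t → HasDerivAt (fun t => ∫ x in (0 : ℝ)..t, b x) (B t) t := by
    intro b B hbB hB t ht
    have h3 : HasDerivAt (fun t => ∫ x in (0 : ℝ)..t, B x) (B t) t := by
      refine intervalIntegral.integral_hasDerivAt_right ?_ ?_ (hB.continuousAt (Ici_mem_nhds ht))
      · refine ContinuousOn.intervalIntegrable (hB.mono ?_)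
        rw [uIcc_of_le ht.le]
        exact Icc_subset_Ici_self
      · exact (hB.mono Ioi_subset_Ici_self).stronglyMeasurableAtFilter isOpen_Ioi t ht
    refine h3.congr_of_eventuallyEq ?_
    filter_upwards [Ioi_mem_nhds ht] with x hx
    refine intervalIntegral.integral_congr_ae_restrict ?_
    refine ae_restrict_of_ae_restrict_of_subset (t := Ici 0) (fun y hy => ?_) hbB
    rw [uIoc_of_le (le_of_lt hx)] at hy
    exact hy.1.le
  have hdA : ∀ t, 0 < t → HasDerivAt A (s * A t - W t) t := fun t ht => by
    refine hprim (b := fun x => s * a x - w x) (B := fun x => s * A x - W x) ?_ ?_ t ht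
    · filter_upwards [h1, h2] with t h1 h2
      rw [h1, h2]
    · exact (continuousOn_const.mul hA).sub hW
  have hdW : ∀ t, 0 < t → HasDerivAt W (-s * W t - A t) t := fun t ht => by
    refine HasDerivAt.add_const c ?_
    refine hprim (b := fun x => -s * w x - a x) (B := fun x => -s * W x - A x) ?_ ?_ t ht
    · filter_upwards [h1, h2] with t h1 h2
      rw [h1, h2]
    · exact (continuousOn_const.mul hW).sub hA
  -- `F = Re (A W̄)`. The terms with `s` cancel in its derivative, leaving `-(|A|² + |W|²)`.
  set F : ℝ → ℝ := fun t => (A t).re * (W t).re + (A t).im * (W t).im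
  have hF : ContinuousOn F (Ici 0) :=
    ((Complex.continuous_re.comp_continuousOn hA).mul (Complex.continuous_re.comp_continuousOn hW)).add
      ((Complex.continuous_im.comp_continuousOn hA).mul
        (Complex.continuous_im.comp_continuousOn hW))
  have hdF : ∀ t, 0 < t → HasDerivAt F (-(Complex.normSq (A t) + Complex.normSq (W t))) t := by
    intro t ht
    have hre : ∀ {f : ℝ → ℂ} {f' : ℂ}, HasDerivAt f f' t →
        HasDerivAt (fun t => (f t).re) f'.re t := fun h =>
      Complex.reCLM.hasFDerivAt.comp_hasDerivAt t h
    have him : ∀ {f : ℝ → ℂ} {f' : ℂ}, HasDerivAt f f' t →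
        HasDerivAt (fun t => (f t).im) f'.im t := fun h =>
      Complex.imCLM.hasFDerivAt.comp_hasDerivAt t h
    have := ((hre (hdA t ht)).mul (hre (hdW t ht))).add ((him (hdA t ht)).mul (him (hdW t ht)))
    convert! this using 1
    simp [Complex.normSq_apply]
    ring
  have hanti : AntitoneOn F (Ici 0) := by
    refine antitoneOn_of_deriv_nonpos (convex_Ici 0) hF ?_ ?_
    · rw [interior_Ici]
      exact fun t ht => (hdF t ht).differentiableAt.differentiableWithinAt
    · rw [interior_Ici]
      intro t ht
      rw [(hdF t ht).deriv]
      have := Complex.normSq_nonneg (A t)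
      have := Complex.normSq_nonneg (W t)
      linarith
  have hA2 : MemLp A 2 halfLine := (memLp_congr_ae h1).1 ha
  have hW2 : MemLp W 2 halfLine := (memLp_congr_ae h2).1 hw
  have hFi : Integrable F halfLine := by
    have := (MemLp.integrable_mul hA2.re hW2.re).add (MemLp.integrable_mul hA2.im hW2.im)
    exact this
  have hF0 : F 0 = 0 := by simp [F, A]
  -- `F` starts at `0` and is nonincreasing. Once negative it would stay below a negative constant
  -- on a half-line, against integrability.
  have hFzero : ∀ t, 0 ≤ t → F t = 0 := by
    intro t ht
    by_contra hne
    have hneg : F t < 0 := lt_of_le_of_ne (hF0 ▸ hanti self_mem_Ici ht ht) hne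
    have hconst : IntegrableOn (fun _ : ℝ => F t) (Ici t) := by
      have h3 : IntegrableOn F (Ici t) := IntegrableOn.mono_set hFi (Ici_subset_Ici.2 ht)
      refine Integrable.mono h3 aestronglyMeasurable_const ?_
      filter_upwards [ae_restrict_mem measurableSet_Ici] with x hx
      have h4 := hanti ht (ht.trans hx) hx
      rw [Real.norm_eq_abs, Real.norm_eq_abs, abs_of_neg hneg, abs_of_neg (by linarith)]
      linarith
    rw [integrableOn_const_iff] at hconst
    rcases hconst with h | h
    · exact hne (by simpa using h)
    · simp at h
  filter_upwards [h1, h2, ae_restrict_mem measurableSet_Ici,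
    (ae_restrict_of_ae (by simp [ae_iff]) : ∀ᵐ t ∂halfLine, t ≠ 0)] with t h1 h2 ht hne
  have htpos : 0 < t := lt_of_le_of_ne ht (Ne.symm hne)
  have h3 : -(Complex.normSq (A t) + Complex.normSq (W t)) = 0 := by
    refine (hdF t htpos).unique ((hasDerivAt_const t (0 : ℝ)).congr_of_eventuallyEq ?_)
    filter_upwards [Ioi_mem_nhds htpos] with x hx using hFzero x (le_of_lt hx)
  have h4 := Complex.normSq_nonneg (A t)
  have h5 := Complex.normSq_nonneg (W t)
  rw [h1, h2]
  exact ⟨Complex.normSq_eq_zero.1 (by linarith), Complex.normSq_eq_zero.1 (by linarith)⟩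

section Tensor

variable {H : Type*} [NormedAddCommGroup H] [InnerProductSpace ℂ H]

/-! ### Elementary tensors in `L²([0, ∞), H)` -/

theorem memLp_smul_const {ψ : ℝ → ℝ} (hψ : MemLp ψ 2 halfLine) (y : H) :
    MemLp (fun t => (ψ t : ℂ) • y) 2 halfLine :=
  (ContinuousLinearMap.toSpanSingleton ℂ y).comp_memLp' hψ.ofReal

/-- The element `ψ ⊗ y` of `L²([0, ∞), H)`, as a linear map in `y`. -/
def tensorₗ {ψ : ℝ → ℝ} (hψ : MemLp ψ 2 halfLine) : H →ₗ[ℂ] HalfLineL2 H where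
  toFun y := (memLp_smul_const hψ y).toLp _
  map_add' x y := by
    rw [← MemLp.toLp_add]
    refine MemLp.toLp_congr _ _ (Filter.Eventually.of_forall fun t => ?_)
    simp
  map_smul' c x := by
    rw [RingHom.id_apply, ← MemLp.toLp_const_smul]
    refine MemLp.toLp_congr _ _ (Filter.Eventually.of_forall fun t => ?_)
    simp [smul_comm c]

theorem coeFn_tensorₗ {ψ : ℝ → ℝ} (hψ : MemLp ψ 2 halfLine) (y : H) :
    tensorₗ hψ y =ᵐ[halfLine] fun t => (ψ t : ℂ) • y :=
  MemLp.coeFn_toLp (memLp_smul_const hψ y)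

theorem inner_tensorₗ {ψ : ℝ → ℝ} (hψ : MemLp ψ 2 halfLine) (y : H) (σ : HalfLineL2 H) :
    ⟪tensorₗ hψ y, σ⟫_ℂ = ∫ t, (ψ t : ℂ) * ⟪y, σ t⟫_ℂ ∂halfLine := by
  rw [L2.inner_def]
  refine integral_congr_ae ?_
  filter_upwards [coeFn_tensorₗ hψ y] with t ht
  rw [ht, inner_smul_left, Complex.conj_ofReal]

theorem inner_tensorₗ_tensorₗ {ψ χ : ℝ → ℝ} (hψ : MemLp ψ 2 halfLine) (hχ : MemLp χ 2 halfLine)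
    (y z : H) : ⟪tensorₗ hψ y, tensorₗ hχ z⟫_ℂ =
      ((∫ t, ψ t * χ t ∂halfLine : ℝ) : ℂ) * ⟪y, z⟫_ℂ := by
  rw [inner_tensorₗ, ← integral_complex_ofReal, ← integral_mul_const]
  refine integral_congr_ae ?_
  filter_upwards [coeFn_tensorₗ hχ z] with t ht
  rw [ht, inner_smul_right]
  push_cast
  ring

theorem norm_tensorₗ {ψ : ℝ → ℝ} (hψ : MemLp ψ 2 halfLine) (y : H) :
    ‖tensorₗ hψ y‖ ^ 2 = (∫ t, ψ t ^ 2 ∂halfLine) * ‖y‖ ^ 2 := by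
  have h := inner_tensorₗ_tensorₗ hψ hψ y y
  rw [inner_self_eq_norm_sq_to_K, inner_self_eq_norm_sq_to_K] at h
  simp_rw [← sq (ψ _)] at h
  have h' : (‖tensorₗ hψ y‖ : ℂ) ^ 2 =
    ((∫ t, ψ t ^ 2 ∂halfLine : ℝ) : ℂ) * (‖y‖ : ℂ) ^ 2 := h
  exact_mod_cast h'

/-- The element `ψ ⊗ y` of `L²([0, ∞), H)`, as a continuous linear map in `y`. -/
def tensor {ψ : ℝ → ℝ} (hψ : MemLp ψ 2 halfLine) : H →L[ℂ] HalfLineL2 H :=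
  (tensorₗ hψ).mkContinuous (Real.sqrt (∫ t, ψ t ^ 2 ∂halfLine)) fun y => by
    rw [← Real.sqrt_sq (norm_nonneg (tensorₗ hψ y)), norm_tensorₗ,
      Real.sqrt_mul' _ (sq_nonneg _), Real.sqrt_sq (norm_nonneg y)]

theorem coeFn_tensor {ψ : ℝ → ℝ} (hψ : MemLp ψ 2 halfLine) (y : H) :
    tensor hψ y =ᵐ[halfLine] fun t => (ψ t : ℂ) • y :=
  coeFn_tensorₗ hψ y

theorem inner_tensor {ψ : ℝ → ℝ} (hψ : MemLp ψ 2 halfLine) (y : H) (σ : HalfLineL2 H) :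
    ⟪tensor hψ y, σ⟫_ℂ = ∫ t, (ψ t : ℂ) * ⟪y, σ t⟫_ℂ ∂halfLine :=
  inner_tensorₗ hψ y σ

theorem inner_tensor_tensor {ψ χ : ℝ → ℝ} (hψ : MemLp ψ 2 halfLine) (hχ : MemLp χ 2 halfLine)
    (y z : H) : ⟪tensor hψ y, tensor hχ z⟫_ℂ =
      ((∫ t, ψ t * χ t ∂halfLine : ℝ) : ℂ) * ⟪y, z⟫_ℂ :=
  inner_tensorₗ_tensorₗ hψ hχ y z

theorem norm_tensor_le {ψ : ℝ → ℝ} (hψ : MemLp ψ 2 halfLine) {K c : ℝ} (hK : 0 ≤ K) (hc : 0 < c)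
    (h : ∀ t, 0 ≤ t → |ψ t| ≤ K * Real.exp (-c * t)) (y : H) :
    ‖tensor hψ y‖ ≤ K / Real.sqrt c * ‖y‖ := by
  refine le_of_sq_le_sq ?_ (by positivity)
  rw [show ‖tensor hψ y‖ ^ 2 = _ from norm_tensorₗ hψ y, mul_pow, div_pow, Real.sq_sqrt hc.le]
  exact mul_le_mul_of_nonneg_right (integral_sq_le_of_abs_le_exp hc h) (sq_nonneg _)

theorem memLp_inner_const (y : H) (σ : HalfLineL2 H) :
    MemLp (fun t => ⟪y, σ t⟫_ℂ) 2 halfLine :=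
  (innerSL ℂ y).comp_memLp' (Lp.memLp σ)

/-! ### The product rule for weak derivatives of Lipschitz functions -/

/-- Expanding around `t`, the only term not covered by the two weak derivatives is the inner product
of the increments, and the Lipschitz bounds make it `O(|s - t|²)`. -/
theorem HasWeakDerivAt.inner {ρ τ : ℝ → H} {v w : H} {t : ℝ} (ht : 0 ≤ t)
    (hρ : HasWeakDerivAt ρ v t) (hτ : HasWeakDerivAt τ w t) {K L : NNReal}
    (hK : LipschitzOnWith K ρ (Icc 0 (t + 1))) (hL : LipschitzOnWith L τ (Icc 0 (t + 1))) :
    HasDerivWithinAt (fun s => ⟪ρ s, τ s⟫_ℂ) (⟪v, τ t⟫_ℂ + ⟪ρ t, w⟫_ℂ) (Ici 0) t := by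
  have h1 : HasDerivWithinAt (fun s => ⟪ρ s, τ t⟫_ℂ) ⟪v, τ t⟫_ℂ (Ici 0) t := by
    have := (Complex.conjCLE : ℂ →L[ℝ] ℂ).hasFDerivAt.comp_hasDerivWithinAt t (hρ (τ t))
    simpa [Function.comp_def] using this
  have h2 : HasDerivWithinAt (fun s => ⟪ρ s - ρ t, τ s - τ t⟫_ℂ) 0 (Ici 0) t := by
    have hO : (fun s => ⟪ρ s - ρ t, τ s - τ t⟫_ℂ) =O[nhdsWithin t (Ici 0)]
        fun s => ‖s - t‖ ^ 2 := by
      refine Asymptotics.IsBigO.of_bound (K * L) ?_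
      filter_upwards [self_mem_nhdsWithin, mem_nhdsWithin_of_mem_nhds
        (Iic_mem_nhds (show t < t + 1 by linarith))] with s hs0 hs1
      have hs : s ∈ Icc 0 (t + 1) := ⟨hs0, hs1⟩
      have ht' : t ∈ Icc 0 (t + 1) := ⟨ht, by linarith⟩
      have e1 := hK.norm_sub_le hs ht'
      have e2 := hL.norm_sub_le hs ht'
      calc ‖⟪ρ s - ρ t, τ s - τ t⟫_ℂ‖ ≤ ‖ρ s - ρ t‖ * ‖τ s - τ t‖ := norm_inner_le_norm _ _
        _ ≤ (K * ‖s - t‖) * (L * ‖s - t‖) := mul_le_mul e1 e2 (norm_nonneg _) (by positivity)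
        _ = K * L * ‖‖s - t‖ ^ 2‖ := by
          rw [norm_pow, norm_norm]
          ring
    have := (hO.hasFDerivWithinAt (show t ∈ Ici 0 from ht) one_lt_two).hasDerivWithinAt
    simpa using this
  have h3 := ((h1.fun_add (hτ (ρ t))).fun_add h2).sub_const ⟪ρ t, τ t⟫_ℂ
  rw [add_zero] at h3
  refine h3.congr_of_mem (fun s _ => ?_) (show t ∈ Ici 0 from ht)
  simp only [inner_sub_left, inner_sub_right]
  ring

theorem LipschitzOnWith.exists_inner {ρ τ : ℝ → H} {T : ℝ} {K L : NNReal}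
    (hK : LipschitzOnWith K ρ (Icc 0 T)) (hL : LipschitzOnWith L τ (Icc 0 T)) :
    ∃ M : NNReal, LipschitzOnWith M (fun s => ⟪ρ s, τ s⟫_ℂ) (Icc 0 T) := by
  obtain ⟨B, hB⟩ := isCompact_Icc.exists_bound_of_continuousOn hK.continuousOn
  obtain ⟨C, hC⟩ := isCompact_Icc.exists_bound_of_continuousOn hL.continuousOn
  refine ⟨K * C.toNNReal + B.toNNReal * L, LipschitzOnWith.of_dist_le_mul fun s hs t ht => ?_⟩
  have e1 := hK.norm_sub_le hs ht
  have e2 := hL.norm_sub_le hs ht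
  have hC' : ‖τ s‖ ≤ (C.toNNReal : ℝ) := (hC s hs).trans (Real.le_coe_toNNReal C)
  have hB' : ‖ρ t‖ ≤ (B.toNNReal : ℝ) := (hB t ht).trans (Real.le_coe_toNNReal B)
  rw [dist_eq_norm, dist_eq_norm]
  have e3 : ⟪ρ s, τ s⟫_ℂ - ⟪ρ t, τ t⟫_ℂ = ⟪ρ s - ρ t, τ s⟫_ℂ + ⟪ρ t, τ s - τ t⟫_ℂ := by
    simp only [inner_sub_left, inner_sub_right]
    ring
  rw [e3]
  calc ‖⟪ρ s - ρ t, τ s⟫_ℂ + ⟪ρ t, τ s - τ t⟫_ℂ‖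
      ≤ ‖ρ s - ρ t‖ * ‖τ s‖ + ‖ρ t‖ * ‖τ s - τ t‖ :=
        (norm_add_le _ _).trans (add_le_add (norm_inner_le_norm _ _) (norm_inner_le_norm _ _))
    _ ≤ (K * ‖s - t‖) * C.toNNReal + B.toNNReal * (L * ‖s - t‖) := by gcongr
    _ = _ := by
        push_cast
        ring

end Tensor

namespace DiracSystem

variable {H : Type*} [NormedAddCommGroup H] [InnerProductSpace ℂ H] [CompleteSpace H]

/-! ### Symmetry of the Dirac operator -/

/-- Green's formula: the difference of the integrands is the derivative of `⟪ρ, γ τ⟫`, since the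
terms with `A` cancel by symmetry and `A γ = -γ A`. The boundary term vanishes already when `ρ`
alone is `0` at `0`. -/
theorem inner_eq_of_isDiracImage (d : DiracSystem H) {ρ τ : ℝ → H} (hρ : IsCompactLip d ρ)
    (hτ : IsCompactLip d τ) (hρ0 : ρ 0 = 0) {q p : HalfLineL2 H × HalfLineL2 H}
    (hq₁ : q.1 =ᵐ[halfLine] ρ) (hq₂ : IsDiracImage d ρ q.2) (hp₁ : p.1 =ᵐ[halfLine] τ)
    (hp₂ : IsDiracImage d τ p.2) : ⟪q.2, p.1⟫_ℂ = ⟪q.1, p.2⟫_ℂ := by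
  set G : ℝ → ℂ := fun t => ⟪q.1 t, p.2 t⟫_ℂ - ⟪q.2 t, p.1 t⟫_ℂ
  have hG : Integrable G halfLine :=
    (L2.integrable_inner (𝕜 := ℂ) q.1 p.2).sub (L2.integrable_inner (𝕜 := ℂ) q.2 p.1)
  have hLip : ∀ T : ℝ, ∃ K : NNReal,
      LipschitzOnWith K (fun t => ⟪ρ t, d.γ (τ t)⟫_ℂ) (Icc 0 T) := by
    intro T
    obtain ⟨K, hK⟩ := hρ.lipschitz T
    obtain ⟨L, hL⟩ := hτ.lipschitz T
    exact LipschitzOnWith.exists_inner hK (d.γ.lipschitz.comp_lipschitzOnWith hL)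
  have hint := integral_halfLine_deriv hLip (g := G) ?_ ?_ hG
  · have h1 : ∫ t, G t ∂halfLine = ⟪q.1, p.2⟫_ℂ - ⟪q.2, p.1⟫_ℂ := by
      rw [L2.inner_def, L2.inner_def, ← integral_sub]
      · exact L2.integrable_inner (𝕜 := ℂ) q.1 p.2
      · exact L2.integrable_inner (𝕜 := ℂ) q.2 p.1
    rw [h1, hρ0, inner_zero_left, neg_zero] at hint
    exact (sub_eq_zero.1 hint).symm
  · obtain ⟨T, hT⟩ := hρ.compactSupport
    exact ⟨T, fun t ht => by simp [hT t ht]⟩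
  · filter_upwards [hq₁, hq₂, hp₁, hp₂, ae_restrict_mem measurableSet_Ici]
      with t h1 ⟨v, hv, hρt, h2⟩ h3 ⟨w, hw, hτt, h4⟩ ht
    obtain ⟨K, hK⟩ := hρ.lipschitz (t + 1)
    obtain ⟨L, hL⟩ := hτ.lipschitz (t + 1)
    have hw' : HasWeakDerivAt (fun s => d.γ (τ s)) (d.γ w) t := by
      intro u
      have := (hw (d.γ u)).fun_neg
      simp only [d.γ_inner, neg_neg] at this
      exact this
    have := HasWeakDerivAt.inner ht hv hw' hK (d.γ.lipschitz.comp_lipschitzOnWith hL)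
    convert! this using 1
    have hanti := d.γ_anticomm ⟨τ t, hτt⟩
    have hsymm := d.A_inner ⟨ρ t, hρt⟩ ⟨d.γ (τ t), d.γ_domain _ hτt⟩
    rw [eq_neg_of_add_eq_zero_left hanti, inner_neg_right] at hsymm
    simp only [G, h1, h2, h3, h4, map_add, inner_add_left, inner_add_right, d.γ_inner] at hsymm ⊢
    rw [hsymm]
    ring

/-! ### Test functions with values in an eigenspace -/

theorem isCompactLip_smul (d : DiracSystem H) {φ φ' : ℝ → ℝ} (hφ : IsTestFunction φ φ') {r : ℝ}
    {x : H} (hx : x ∈ d.eigenspace r) : IsCompactLip d fun t => (φ t : ℂ) • x where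
  lipschitz T := by
    obtain ⟨K, hK⟩ := hφ.lipschitz T
    exact ⟨_, (ContinuousLinearMap.toSpanSingleton ℂ x).lipschitz.comp_lipschitzOnWith
      (Complex.ofRealCLM.lipschitz.comp_lipschitzOnWith hK)⟩
  bounded T := by
    obtain ⟨hxd, hA⟩ := d.mem_eigenspace_iff.1 hx
    obtain ⟨K, hK⟩ := hφ.lipschitz T
    obtain ⟨C, hC⟩ := isCompact_Icc.exists_bound_of_continuousOn hK.continuousOn
    refine ⟨C * ‖(r : ℂ) • x‖, ?_⟩
    filter_upwards [ae_restrict_mem measurableSet_Icc] with t ht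
    refine ⟨d.A.domain.smul_mem _ hxd, ?_⟩
    rw [show (⟨(φ t : ℂ) • x, d.A.domain.smul_mem _ hxd⟩ : d.A.domain) =
      (φ t : ℂ) • (⟨x, hxd⟩ : d.A.domain) from rfl, d.A.map_smul, hA, norm_smul,
      Complex.norm_real]
    exact mul_le_mul_of_nonneg_right (hC t ht) (norm_nonneg _)
  compactSupport := by
    obtain ⟨T, hT⟩ := hφ.compactSupport
    exact ⟨T, fun t ht => by simp [hT t ht]⟩

theorem isDiracImage_smul (d : DiracSystem H) {φ φ' : ℝ → ℝ} (hφ : IsTestFunction φ φ') {r : ℝ}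
    {x : H} (hx : x ∈ d.eigenspace r) :
    IsDiracImage d (fun t => (φ t : ℂ) • x)
      fun t => ((φ' t + r * φ t : ℝ) : ℂ) • d.γ x := by
  obtain ⟨hxd, hA⟩ := d.mem_eigenspace_iff.1 hx
  filter_upwards [hφ.deriv] with t ht
  refine ⟨(φ' t : ℂ) • x, fun u => ?_, d.A.domain.smul_mem _ hxd, ?_⟩
  · simp only [inner_smul_right]
    exact ((Complex.ofRealCLM.hasFDerivAt.comp_hasDerivWithinAt t ht :
      HasDerivWithinAt (fun s => (φ s : ℂ)) (φ' t : ℂ) (Ici 0) t)).mul_const _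
  · rw [show (⟨(φ t : ℂ) • x, d.A.domain.smul_mem _ hxd⟩ : d.A.domain) =
      (φ t : ℂ) • (⟨x, hxd⟩ : d.A.domain) from rfl, d.A.map_smul, hA, smul_smul, ← add_smul,
      map_smul]
    congr 1
    push_cast
    ring

theorem _root_.IsTestFunction.memLp_deriv_add {φ φ' : ℝ → ℝ} (hφ : IsTestFunction φ φ') (r : ℝ) :
    MemLp (fun t => φ' t + r * φ t) 2 halfLine :=
  hφ.memLp_deriv.add (hφ.memLp.const_mul r)

/-- The pair `(φ ⊗ x, D (φ ⊗ x))`, for an eigenvector `x` of `A` with eigenvalue `r`. -/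
def testPair (d : DiracSystem H) {φ φ' : ℝ → ℝ} (hφ : IsTestFunction φ φ') (r : ℝ) (x : H) :
    HalfLineL2 H × HalfLineL2 H :=
  (tensor hφ.memLp x, tensor (hφ.memLp_deriv_add r) (d.γ x))

theorem isDiracImage_testPair (d : DiracSystem H) {φ φ' : ℝ → ℝ} (hφ : IsTestFunction φ φ')
    {r : ℝ} {x : H} (hx : x ∈ d.eigenspace r) :
    IsDiracImage d (fun t => (φ t : ℂ) • x) (d.testPair hφ r x).2 := by
  filter_upwards [d.isDiracImage_smul hφ hx, coeFn_tensor (hφ.memLp_deriv_add r) (d.γ x)]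
    with t ⟨v, hv, h, h1⟩ h2
  exact ⟨v, hv, h, h2.trans h1⟩

theorem testPair_mem_graphZeroC (d : DiracSystem H) {φ φ' : ℝ → ℝ} (hφ : IsTestFunction φ φ')
    (hφ0 : φ 0 = 0) {r : ℝ} {x : H} (hx : x ∈ d.eigenspace r) :
    d.testPair hφ r x ∈ d.graphZeroC :=
  ⟨_, d.isCompactLip_smul hφ hx, by simp [hφ0], coeFn_tensor hφ.memLp x,
    d.isDiracImage_testPair hφ hx⟩

/-- The pairing of a test function with an arbitrary pair, in terms of scalar functions. -/
theorem inner_testPair (d : DiracSystem H) {φ φ' : ℝ → ℝ} (hφ : IsTestFunction φ φ') (r : ℝ)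
    (x : H) (σ g : HalfLineL2 H) :
    ⟪(d.testPair hφ r x).2, σ⟫_ℂ - ⟪(d.testPair hφ r x).1, g⟫_ℂ =
      ∫ t, ((φ' t : ℂ) * ⟪d.γ x, σ t⟫_ℂ +
        (φ t : ℂ) * (r * ⟪d.γ x, σ t⟫_ℂ - ⟪x, g t⟫_ℂ)) ∂halfLine := by
  have h1 : (d.testPair hφ r x).2 = tensor (hφ.memLp_deriv_add r) (d.γ x) := rfl
  have h2 : (d.testPair hφ r x).1 = tensor hφ.memLp x := rfl
  rw [h1, h2, inner_tensor, inner_tensor, ← integral_sub]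
  · refine integral_congr_ae (Filter.Eventually.of_forall fun t => ?_)
    simp only
    push_cast
    ring
  · exact MemLp.integrable_mul (hφ.memLp_deriv_add r).ofReal (memLp_inner_const _ σ)
  · exact MemLp.integrable_mul hφ.memLp.ofReal (memLp_inner_const _ g)

theorem memLp_test_coefficient (d : DiracSystem H) (σ g : HalfLineL2 H) (r : ℝ) (x : H) :
    MemLp (fun t => r * ⟪d.γ x, σ t⟫_ℂ - ⟪x, g t⟫_ℂ) 2 halfLine :=
  ((memLp_inner_const _ σ).const_mul (r : ℂ)).sub (memLp_inner_const _ g)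

variable [TopologicalSpace.SeparableSpace H]

/-- A vector orthogonal to all `φ ⊗ x` has coefficients `⟪x, σ⟫` annihilated by every test function
vanishing at `0`. Density is what gives the adjoint `D_max` its usual meaning. -/
theorem dense_DZeroC_domain (d : DiracSystem H) : Dense (d.DZeroC.domain : Set (HalfLineL2 H)) := by
  rw [Submodule.dense_iff_topologicalClosure_eq_top, Submodule.topologicalClosure_eq_top_iff,
    Submodule.eq_bot_iff]
  intro σ hσ
  rw [Submodule.mem_orthogonal] at hσ
  refine Lp.ext ?_
  refine Filter.EventuallyEq.trans ?_ (Lp.coeFn_zero H 2 halfLine).symm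
  refine d.ae_eq_zero_of_forall_eigenspace fun r x hx => ?_
  refine ae_eq_zero_of_forall_test (memLp_inner_const x σ) fun φ φ' hφ hφ0 => ?_
  rw [← inner_tensor hφ.memLp]
  refine hσ _ ?_
  have h := d.testPair_mem_graphZeroC hφ hφ0 hx
  rw [← d.DZeroC_graph] at h
  exact LinearPMap.mem_domain_of_mem_graph h

theorem mem_DMax_graph_iff (d : DiracSystem H) {p : HalfLineL2 H × HalfLineL2 H} :
    p ∈ d.DMax.graph ↔ ∀ q ∈ d.graphZeroC, ⟪q.2, p.1⟫_ℂ = ⟪q.1, p.2⟫_ℂ := by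
  rw [DMax, LinearPMap.adjoint_graph_eq_graph_adjoint d.dense_DZeroC_domain,
    Submodule.mem_adjoint_iff, DZeroC_graph]
  simp only [sub_eq_zero, Prod.forall]

theorem isClosed_DMax_graph (d : DiracSystem H) :
    IsClosed (d.DMax.graph : Set (HalfLineL2 H × HalfLineL2 H)) :=
  LinearPMap.adjoint_isClosed d.dense_DZeroC_domain

theorem mem_DMax_graph_of_isCompactLip (d : DiracSystem H) {τ : ℝ → H} (hτ : IsCompactLip d τ)
    {p : HalfLineL2 H × HalfLineL2 H} (hp₁ : p.1 =ᵐ[halfLine] τ) (hp₂ : IsDiracImage d τ p.2) :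
    p ∈ d.DMax.graph := by
  rw [mem_DMax_graph_iff]
  rintro q ⟨ρ, hρ, hρ0, hq₁, hq₂⟩
  exact d.inner_eq_of_isDiracImage hρ hτ hρ0 hq₁ hq₂ hp₁ hp₂

theorem DZeroC_le_DMax (d : DiracSystem H) : d.DZeroC ≤ d.DMax := by
  refine LinearPMap.le_of_le_graph ?_
  rw [DZeroC_graph]
  rintro p ⟨τ, hτ, -, hp₁, hp₂⟩
  exact d.mem_DMax_graph_of_isCompactLip hτ hp₁ hp₂

/-- The scalar form of `D_max σ = g` along `γ x`: the function `⟪γ x, σ⟫` has weak derivative `r ⟪γ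
x, σ⟫ - ⟪x, g⟫`. -/
theorem integral_test_eq_zero (d : DiracSystem H) {σ g : HalfLineL2 H}
    (hp : (σ, g) ∈ d.DMax.graph) {r : ℝ} {x : H} (hx : x ∈ d.eigenspace r) {φ φ' : ℝ → ℝ}
    (hφ : IsTestFunction φ φ') (hφ0 : φ 0 = 0) :
    ∫ t, ((φ' t : ℂ) * ⟪d.γ x, σ t⟫_ℂ +
      (φ t : ℂ) * (r * ⟪d.γ x, σ t⟫_ℂ - ⟪x, g t⟫_ℂ)) ∂halfLine = 0 := by
  rw [← d.inner_testPair hφ r x σ g, sub_eq_zero]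
  exact d.mem_DMax_graph_iff.1 hp _ (d.testPair_mem_graphZeroC hφ hφ0 hx)

end DiracSystem

/-! ### Sums of bounded operators with orthogonal ranges -/

section OrthogonalSum

variable {ι : Type*} {G : ι → Type*} [∀ i, NormedAddCommGroup (G i)]
  [∀ i, InnerProductSpace ℂ (G i)] [∀ i, CompleteSpace (G i)] {E : Type*} [NormedAddCommGroup E]
  [InnerProductSpace ℂ E] [CompleteSpace E]

-- A Bessel inequality. Let `X` be the sum and `u = ∑ V_i V_i* e`. Then `X = ⟪u, e⟫`, while
-- orthogonality of the ranges gives `‖u‖² ≤ C² X`; hence `X² ≤ C² X ‖e‖²`.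
open ContinuousLinearMap in
theorem sum_norm_adjoint_sq_le {V : ∀ i, G i →L[ℂ] E} {C : ℝ} (hV : ∀ i x, ‖V i x‖ ≤ C * ‖x‖)
    (horth : ∀ i j, i ≠ j → ∀ x y, ⟪V i x, V j y⟫_ℂ = 0) (s : Finset ι) (e : E) :
    ∑ i ∈ s, ‖adjoint (V i) e‖ ^ 2 ≤ C ^ 2 * ‖e‖ ^ 2 := by
  set X := ∑ i ∈ s, ‖adjoint (V i) e‖ ^ 2
  set u := ∑ i ∈ s, V i (adjoint (V i) e)
  have hX0 : 0 ≤ X := Finset.sum_nonneg fun _ _ => sq_nonneg _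
  have h1 : X ≤ ‖u‖ * ‖e‖ := by
    have : (X : ℂ) = ⟪u, e⟫_ℂ := by
      rw [sum_inner]
      push_cast [X]
      refine Finset.sum_congr rfl fun i _ => ?_
      rw [← adjoint_inner_right, inner_self_eq_norm_sq_to_K]
      rfl
    calc X = ‖(X : ℂ)‖ := by rw [Complex.norm_real, Real.norm_of_nonneg hX0]
      _ ≤ _ := this ▸ norm_inner_le_norm _ _
  have h2 : ‖u‖ ^ 2 ≤ C ^ 2 * X := by
    have h3 : ((‖u‖ ^ 2 : ℝ) : ℂ) = ((∑ i ∈ s, ‖V i (adjoint (V i) e)‖ ^ 2 : ℝ) : ℂ) := by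
      have : ⟪u, u⟫_ℂ = ∑ i ∈ s, ⟪V i (adjoint (V i) e), V i (adjoint (V i) e)⟫_ℂ := by
        rw [sum_inner]
        refine Finset.sum_congr rfl fun i hi => ?_
        rw [inner_sum]
        exact Finset.sum_eq_single_of_mem i hi fun j _ hj => horth i j hj.symm _ _
      simp only [inner_self_eq_norm_sq_to_K] at this
      push_cast
      exact this
    rw [Complex.ofReal_inj.1 h3, Finset.mul_sum]
    refine Finset.sum_le_sum fun i _ => ?_
    rw [← mul_pow]
    exact pow_le_pow_left₀ (norm_nonneg _) (hV i _) 2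
  rcases hX0.eq_or_lt with h0 | hpos
  · rw [← h0]
    positivity
  · have h4 : X * X ≤ X * (C ^ 2 * ‖e‖ ^ 2) := by
      calc X * X ≤ (‖u‖ * ‖e‖) * (‖u‖ * ‖e‖) := mul_le_mul h1 h1 hX0 (by positivity)
        _ = ‖u‖ ^ 2 * ‖e‖ ^ 2 := by ring
        _ ≤ (C ^ 2 * X) * ‖e‖ ^ 2 := by gcongr
        _ = _ := by ring
    exact le_of_mul_le_mul_left h4 hpos

/-- The operator from a Hilbert space to a Hilbert sum whose components are the adjoints of
uniformly bounded operators with pairwise orthogonal ranges. -/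
theorem exists_adjoint_orthogonalSum {V : ∀ i, G i →L[ℂ] E} {C : ℝ}
    (hV : ∀ i x, ‖V i x‖ ≤ C * ‖x‖)
    (horth : ∀ i j, i ≠ j → ∀ x y, ⟪V i x, V j y⟫_ℂ = 0) :
    ∃ W : E →L[ℂ] lp G 2, ∀ i x e, ⟪x, W e i⟫_ℂ = ⟪V i x, e⟫_ℂ := by
  have hsum := sum_norm_adjoint_sq_le hV horth
  have hmem : ∀ e : E, Memℓp (fun i => ContinuousLinearMap.adjoint (V i) e) 2 := by
    intro e
    refine memℓp_gen ?_
    simp only [ENNReal.toReal_ofNat, Real.rpow_two]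
    exact summable_of_sum_le (fun _ => sq_nonneg _) (fun s => hsum s e)
  let W : E →ₗ[ℂ] lp G 2 :=
    { toFun := fun e => ⟨fun i => ContinuousLinearMap.adjoint (V i) e, hmem e⟩
      map_add' := fun x y => Subtype.ext (funext fun i => map_add _ x y)
      map_smul' := fun c x => Subtype.ext (funext fun i => map_smul _ c x) }
  refine ⟨W.mkContinuous |C| fun e => ?_, fun i x e => ?_⟩
  · refine le_of_sq_le_sq ?_ (by positivity)
    rw [mul_pow, sq_abs]
    have h := lp.norm_rpow_eq_tsum (p := 2) (by norm_num) (W e)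
    simp only [ENNReal.toReal_ofNat, Real.rpow_two] at h
    rw [h]
    exact Real.tsum_le_of_sum_le (fun _ => sq_nonneg _) fun s => hsum s e
  · exact ContinuousLinearMap.adjoint_inner_right _ _ _

end OrthogonalSum

namespace DiracSystem

variable {H : Type*} [NormedAddCommGroup H] [InnerProductSpace ℂ H] [CompleteSpace H]

/-! ### The space of boundary values as a Hilbert sum -/

theorem sobolevWeight_pos (s r : ℝ) : 0 < (1 + r ^ 2) ^ (s / 2) :=
  Real.rpow_pos_of_pos (by positivity) _

theorem sobolevWeight_ne_zero (s r : ℝ) : sobolevWeight s r ≠ 0 := by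
  rw [sobolevWeight]
  exact_mod_cast (sobolevWeight_pos s r).ne'

open scoped Classical in
theorem memℓp_ite (d : DiracSystem H) (J : Set ℝ) (ℓ : lp (fun r : ℝ => d.eigenspace r) 2) :
    Memℓp (fun r : ℝ => if r ∈ J then ℓ r else 0) 2 := by
  have h : Summable fun r : ℝ => ‖ℓ r‖ ^ (2 : ℝ≥0∞).toReal := (lp.memℓp ℓ).summable (by norm_num)
  refine memℓp_gen (h.of_nonneg_of_le (fun r => by positivity) fun r => ?_)
  split_ifs
  · exact le_rfl
  · simp

open scoped Classical in
/-- The map from the Hilbert sum of the eigenspaces onto `H^s_J` that divides by the weight. -/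
def sobolevOfLpₗ (d : DiracSystem H) (s : ℝ) (J : Set ℝ) :
    lp (fun r : ℝ => d.eigenspace r) 2 →ₗ[ℂ] d.SobolevOn s J where
  toFun ℓ := ⟨⟨fun r => if r ∈ J then (sobolevWeight s r)⁻¹ • ℓ r else 0, by
      change Memℓp _ 2
      convert! d.memℓp_ite J ℓ using 2 with r
      by_cases hr : r ∈ J
      · simp only [if_pos hr]
        exact smul_inv_smul₀ (sobolevWeight_ne_zero s r) _
      · simp only [if_neg hr]
        exact smul_zero _⟩, fun r hr => if_neg hr⟩
  map_add' x y := by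
    refine Subtype.ext (Subtype.ext (funext fun r => ?_))
    change (if r ∈ J then (sobolevWeight s r)⁻¹ • (x r + y r) else 0) =
      (if r ∈ J then (sobolevWeight s r)⁻¹ • x r else 0) +
        (if r ∈ J then (sobolevWeight s r)⁻¹ • y r else 0)
    split_ifs
    · exact smul_add _ _ _
    · rw [add_zero]
  map_smul' c x := by
    refine Subtype.ext (Subtype.ext (funext fun r => ?_))
    change (if r ∈ J then (sobolevWeight s r)⁻¹ • (c • x r) else 0) =
      c • (if r ∈ J then (sobolevWeight s r)⁻¹ • x r else 0)
    split_ifs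
    · exact smul_comm _ _ _
    · rw [smul_zero]

open scoped Classical in
theorem component_sobolevOfLpₗ (d : DiracSystem H) (s : ℝ) (J : Set ℝ)
    (ℓ : lp (fun r : ℝ => d.eigenspace r) 2) (r : ℝ) :
    Sobolev.component r (d.sobolevOfLpₗ s J ℓ : d.Sobolev s) =
      if r ∈ J then (sobolevWeight s r)⁻¹ • ℓ r else 0 := rfl

/-- The continuous version of `sobolevOfLpₗ`. -/
def sobolevOfLp (d : DiracSystem H) (s : ℝ) (J : Set ℝ) :
    lp (fun r : ℝ => d.eigenspace r) 2 →L[ℂ] d.SobolevOn s J :=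
  (d.sobolevOfLpₗ s J).mkContinuous 1 fun ℓ => by
    classical
    rw [one_mul]
    refine le_of_sq_le_sq ?_ (norm_nonneg _)
    have h1 := Sobolev.hasSum_norm_sq (d.sobolevOfLpₗ s J ℓ : d.Sobolev s)
    have h2 := lp.hasSum_norm (p := 2) (by norm_num) ℓ
    simp only [ENNReal.toReal_ofNat, Real.rpow_two] at h2
    refine hasSum_le (fun r => ?_) h1 h2
    rw [component_sobolevOfLpₗ]
    have hw := sobolevWeight_pos s r
    split_ifs
    · have h0 : (0 : ℝ) ≤ 1 + r ^ 2 := by positivity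
      have e : (1 + r ^ 2) ^ s = ((1 + r ^ 2) ^ (s / 2)) ^ 2 := by
        rw [← Real.rpow_mul_natCast h0]
        congr 1
        push_cast
        ring
      rw [norm_smul, norm_inv, sobolevWeight, Complex.norm_real, Real.norm_of_nonneg hw.le, e,
        mul_pow, ← mul_assoc, ← mul_pow, mul_inv_cancel₀ hw.ne', one_pow, one_mul]
    · rw [norm_zero, zero_pow two_ne_zero, mul_zero]
      exact sq_nonneg _

/-- The isometry `(1 + A²)^{s/2}` from `H^s` to the Hilbert sum of the eigenspaces. -/
def weightedL (d : DiracSystem H) (s : ℝ) :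
    d.Sobolev s →L[ℂ] lp (fun r : ℝ => d.eigenspace r) 2 :=
  (Sobolev.weighted (d := d) (s := s)).mkContinuous 1 fun x => by
    rw [one_mul]
    exact le_of_eq rfl

/-- The weight `(1 + r²)^{-1/4}` for `r > 0` and `(1 + r²)^{1/4}` for `r ≤ 0`. -/
def checkWeight (r : ℝ) : ℝ :=
  if 0 < r then (1 + r ^ 2) ^ (-(1 / 2 : ℝ) / 2) else (1 + r ^ 2) ^ ((1 / 2 : ℝ) / 2)

theorem checkWeight_pos (r : ℝ) : 0 < checkWeight r := by
  rw [checkWeight]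
  split_ifs <;> exact sobolevWeight_pos _ _

/-- Since `γ` maps `ker (A - r)` to `ker (A + r)`, this reciprocity makes the pairing `⟪γ x, y⟫`
bounded on `Ȟ`, and one estimate serves both the boundary and the extension map. -/
theorem checkWeight_neg (r : ℝ) : checkWeight (-r) = (checkWeight r)⁻¹ := by
  have h0 : (0 : ℝ) ≤ 1 + r ^ 2 := by positivity
  rcases lt_trichotomy r 0 with h | h | h
  · rw [checkWeight, checkWeight, if_pos (by linarith), if_neg (by linarith), neg_sq,
      ← Real.rpow_neg h0, neg_div]
  · simp [h, checkWeight]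
  · rw [checkWeight, checkWeight, if_neg (by linarith), if_pos h, neg_sq, ← Real.rpow_neg h0,
      neg_div, neg_neg]

/-- The map from the Hilbert sum of the eigenspaces onto `Ȟ` that divides by the weight. -/
def checkOfLp (d : DiracSystem H) : lp (fun r : ℝ => d.eigenspace r) 2 →L[ℂ] d.CheckH :=
  (d.sobolevOfLp (-(1 / 2)) (Ioi 0)).prod
    ((lp.evalCLM ℂ (fun r : ℝ => d.eigenspace r) 2 (0 : ℝ)).prod (d.sobolevOfLp (1 / 2) (Iio 0)))

open scoped Classical in
/-- The map from `Ȟ` to the Hilbert sum of the eigenspaces that multiplies by the weight. -/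
def lpOfCheck (d : DiracSystem H) : d.CheckH →L[ℂ] lp (fun r : ℝ => d.eigenspace r) 2 :=
  (d.weightedL (-(1 / 2)) ∘L (d.SobolevOn (-(1 / 2)) (Ioi 0)).subtypeL).coprod
    ((lp.singleContinuousLinearMap ℂ (fun r : ℝ => d.eigenspace r) 2 (0 : ℝ)).coprod
      (d.weightedL (1 / 2) ∘L (d.SobolevOn (1 / 2) (Iio 0)).subtypeL))

theorem checkOfLp_component_pos (d : DiracSystem H) (ℓ : lp (fun r : ℝ => d.eigenspace r) 2)
    {r : ℝ} (hr : 0 < r) :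
    Sobolev.component r ((d.checkOfLp ℓ).1 : d.Sobolev (-(1 / 2))) =
      ((checkWeight r : ℂ))⁻¹ • ℓ r := by
  classical
  refine (d.component_sobolevOfLpₗ (-(1 / 2)) (Ioi 0) ℓ r).trans ?_
  rw [if_pos (show r ∈ Ioi 0 from hr), sobolevWeight, checkWeight, if_pos hr]

theorem checkOfLp_zero (d : DiracSystem H) (ℓ : lp (fun r : ℝ => d.eigenspace r) 2) :
    (d.checkOfLp ℓ).2.1 = ℓ 0 := rfl

theorem checkOfLp_component_neg (d : DiracSystem H) (ℓ : lp (fun r : ℝ => d.eigenspace r) 2)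
    {r : ℝ} (hr : r < 0) :
    Sobolev.component r ((d.checkOfLp ℓ).2.2 : d.Sobolev (1 / 2)) =
      ((checkWeight r : ℂ))⁻¹ • ℓ r := by
  classical
  refine (d.component_sobolevOfLpₗ (1 / 2) (Iio 0) ℓ r).trans ?_
  rw [if_pos (show r ∈ Iio 0 from hr), sobolevWeight, checkWeight, if_neg (by linarith)]

/-- The elements of `Ȟ` are determined by their components. -/
theorem CheckH.ext_component {d : DiracSystem H} {X Y : d.CheckH}
    (h₁ : ∀ r : ℝ, 0 < r → Sobolev.component r (X.1 : d.Sobolev (-(1 / 2))) =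
      Sobolev.component r (Y.1 : d.Sobolev (-(1 / 2))))
    (h₂ : X.2.1 = Y.2.1)
    (h₃ : ∀ r : ℝ, r < 0 → Sobolev.component r (X.2.2 : d.Sobolev (1 / 2)) =
      Sobolev.component r (Y.2.2 : d.Sobolev (1 / 2))) : X = Y := by
  refine Prod.ext (Subtype.ext (Subtype.ext (funext fun r => ?_)))
    (Prod.ext h₂ (Subtype.ext (Subtype.ext (funext fun r => ?_))))
  · by_cases hr : 0 < r
    · exact h₁ r hr
    · exact (X.1.2 r hr).trans (Y.1.2 r hr).symm
  · by_cases hr : r < 0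
    · exact h₃ r hr
    · exact (X.2.2.2 r hr).trans (Y.2.2.2 r hr).symm

theorem IsVector.unique {d : DiracSystem H} {X Y : d.CheckH} {x : H} (hX : d.IsVector X x)
    (hY : d.IsVector Y x) : X = Y :=
  CheckH.ext_component (fun r hr => Subtype.ext ((hX.1 r hr).trans (hY.1 r hr).symm))
    (Subtype.ext (hX.2.1.trans hY.2.1.symm))
    (fun r hr => Subtype.ext ((hX.2.2 r hr).trans (hY.2.2 r hr).symm))

theorem checkOfLp_lpOfCheck (d : DiracSystem H) (X : d.CheckH) :
    d.checkOfLp (d.lpOfCheck X) = X := by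
  classical
  have happ : ∀ r : ℝ, d.lpOfCheck X r =
      sobolevWeight (-(1 / 2)) r • Sobolev.component r (X.1 : d.Sobolev (-(1 / 2))) +
      ((lp.single 2 (0 : ℝ) X.2.1 : lp (fun r : ℝ => d.eigenspace r) 2) r +
        sobolevWeight (1 / 2) r • Sobolev.component r (X.2.2 : d.Sobolev (1 / 2))) :=
    fun r => rfl
  refine CheckH.ext_component (fun r hr => ?_) ?_ (fun r hr => ?_)
  · rw [checkOfLp_component_pos d _ hr, happ, X.2.2.2 r (by simpa using hr.le),
      lp.single_apply_ne 2 _ _ hr.ne', smul_zero, add_zero, add_zero, smul_smul, sobolevWeight,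
      checkWeight, if_pos hr, inv_mul_cancel₀, one_smul]
    exact_mod_cast (sobolevWeight_pos _ r).ne'
  · rw [checkOfLp_zero, happ, X.1.2 0 (by simp), X.2.2.2 0 (by simp), lp.single_apply_self]
    simp
  · rw [checkOfLp_component_neg d _ hr, happ, X.1.2 r (by simpa using hr.le),
      lp.single_apply_ne 2 _ _ hr.ne, smul_zero, zero_add, zero_add, smul_smul, sobolevWeight,
      checkWeight, if_neg (by linarith), inv_mul_cancel₀, one_smul]
    exact_mod_cast (sobolevWeight_pos _ r).ne'

theorem eq_zero_of_checkOfLp_eq_zero (d : DiracSystem H)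
    {ℓ : lp (fun r : ℝ => d.eigenspace r) 2} (h : d.checkOfLp ℓ = 0) : ℓ = 0 := by
  have hw : ∀ r, ((checkWeight r : ℂ))⁻¹ ≠ 0 := fun r =>
    inv_ne_zero (by exact_mod_cast (checkWeight_pos r).ne')
  refine lp.ext (funext fun r => ?_)
  rcases lt_trichotomy r 0 with hr | rfl | hr
  · have := d.checkOfLp_component_neg ℓ hr
    rw [h] at this
    exact (smul_eq_zero.1 this.symm).resolve_left (hw r)
  · rw [← checkOfLp_zero, h]
    rfl
  · have := d.checkOfLp_component_pos ℓ hr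
    rw [h] at this
    exact (smul_eq_zero.1 this.symm).resolve_left (hw r)

end DiracSystem

/-- Finite sums of single components are dense, so closed conditions on a Hilbert sum need checking
on one eigenspace at a time. -/
theorem lp.eq_top_of_single_mem {ι : Type*} [DecidableEq ι] {G : ι → Type*}
    [∀ i, NormedAddCommGroup (G i)] [∀ i, InnerProductSpace ℂ (G i)] {K : Submodule ℂ (lp G 2)}
    (hK : IsClosed (K : Set (lp G 2))) (h : ∀ i x, lp.single 2 i x ∈ K) (ℓ : lp G 2) : ℓ ∈ K :=
  hK.mem_of_tendsto (lp.hasSum_single (by norm_num) ℓ)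
    (Filter.Eventually.of_forall fun _ => K.sum_mem fun i _ => h i _)

namespace DiracSystem

variable {H : Type*} [NormedAddCommGroup H] [InnerProductSpace ℂ H] [CompleteSpace H]

/-! ### Estimates for the model extensions of boundary values -/

theorem one_le_sqrt_one_add_sq (r : ℝ) : 1 ≤ √(1 + r ^ 2) :=
  Real.one_le_sqrt.2 (by linarith [sq_nonneg r])

theorem sqrt_one_add_sq_pos (r : ℝ) : 0 < √(1 + r ^ 2) :=
  zero_lt_one.trans_le (one_le_sqrt_one_add_sq r)

/-- The model extension `e^{-t √(1 + r²)} (1 - t)₊ x` of the boundary value `x`, together with its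
image under the Dirac operator. -/
def modelPair (d : DiracSystem H) (r : ℝ) (x : H) : HalfLineL2 H × HalfLineL2 H :=
  d.testPair (isTestFunction_profile (sqrt_one_add_sq_pos r)) r x

theorem sqrt_sqrt_one_add_sq (r : ℝ) : √√(1 + r ^ 2) = (1 + r ^ 2) ^ ((1 / 2 : ℝ) / 2) := by
  rw [Real.sqrt_eq_rpow, Real.sqrt_eq_rpow, ← Real.rpow_mul (by positivity)]
  congr 1
  norm_num

theorem checkWeight_of_pos {r : ℝ} (hr : 0 < r) : checkWeight r = (√√(1 + r ^ 2))⁻¹ := by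
  rw [checkWeight, if_pos hr, sqrt_sqrt_one_add_sq, neg_div, Real.rpow_neg (by positivity)]

theorem checkWeight_of_nonpos {r : ℝ} (hr : r ≤ 0) : checkWeight r = √√(1 + r ^ 2) := by
  rw [checkWeight, if_neg (not_lt.2 hr), sqrt_sqrt_one_add_sq]

/-- With `c = √(1 + r²)` the `L²` norm is at most `c^{-1/2} ‖x‖`. This is the weight for `r > 0`,
and is below the weight `c^{1/2}` for `r ≤ 0` because `c ≥ 1`. -/
theorem norm_modelPair_fst_le (d : DiracSystem H) (r : ℝ) (x : H) :
    ‖(d.modelPair r x).1‖ ≤ 3 * checkWeight r * ‖x‖ := by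
  have hc := sqrt_one_add_sq_pos r
  have h1 : 1 ≤ √√(1 + r ^ 2) := Real.one_le_sqrt.2 (one_le_sqrt_one_add_sq r)
  refine (norm_tensor_le _ zero_le_one hc (fun t ht => abs_profile_le ht) x).trans ?_
  refine mul_le_mul_of_nonneg_right ?_ (norm_nonneg x)
  rw [one_div]
  rcases lt_or_ge 0 r with hr | hr
  · rw [checkWeight_of_pos hr]
    have : 0 < (√√(1 + r ^ 2))⁻¹ := by positivity
    linarith
  · rw [checkWeight_of_nonpos hr]
    have := inv_le_one_of_one_le₀ h1
    linarith

/-- The norm is at most `(|r - c| + 1) c^{-1/2} ‖x‖` with `c = √(1 + r²)`. For `r > 0`, `c - r ≤ 1`;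
for `r ≤ 0`, `|r - c| + 1 ≤ 3 c`, the origin of the constant `3`. This asymmetry is why `Ȟ` has
exponent `-1/2` on the positive and `1/2` on the negative side. -/
theorem norm_modelPair_snd_le (d : DiracSystem H) (r : ℝ) (x : H) :
    ‖(d.modelPair r x).2‖ ≤ 3 * checkWeight r * ‖x‖ := by
  have hc := sqrt_one_add_sq_pos r
  have h1 := one_le_sqrt_one_add_sq r
  have h2 : 0 < √√(1 + r ^ 2) := Real.sqrt_pos.2 hc
  have h3 := Real.sq_sqrt (show 0 ≤ 1 + r ^ 2 by positivity)
  refine (norm_tensor_le _ (by positivity) hc (fun t ht => abs_profileDeriv_add_le r ht)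
    (d.γ x)).trans ?_
  rw [d.norm_γ]
  refine mul_le_mul_of_nonneg_right ?_ (norm_nonneg x)
  rcases lt_or_ge 0 r with hr | hr
  · rw [checkWeight_of_pos hr, div_eq_mul_inv]
    refine mul_le_mul_of_nonneg_right ?_ (by positivity)
    have h4 : √(1 + r ^ 2) ≤ 1 + r := by
      rw [Real.sqrt_le_left (by linarith)]
      nlinarith
    have h5 : r ≤ √(1 + r ^ 2) := Real.le_sqrt_of_sq_le (by linarith)
    rw [abs_of_nonpos (by linarith)]
    linarith
  · rw [checkWeight_of_nonpos hr, div_le_iff₀ h2, mul_assoc, Real.mul_self_sqrt hc.le]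
    have h5 : -r ≤ √(1 + r ^ 2) := Real.le_sqrt_of_sq_le (by linarith [neg_sq r])
    rw [abs_of_nonpos (by linarith)]
    linarith

theorem modelPair_fst_orthogonal (d : DiracSystem H) {r s : ℝ} (hrs : r ≠ s) {x y : H}
    (hx : x ∈ d.eigenspace r) (hy : y ∈ d.eigenspace s) :
    ⟪(d.modelPair r x).1, (d.modelPair s y).1⟫_ℂ = 0 := by
  refine (inner_tensor_tensor _ _ x y).trans ?_
  rw [d.eigenspace_orthogonal hrs hx hy, mul_zero]

theorem modelPair_snd_orthogonal (d : DiracSystem H) {r s : ℝ} (hrs : r ≠ s) {x y : H}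
    (hx : x ∈ d.eigenspace r) (hy : y ∈ d.eigenspace s) :
    ⟪(d.modelPair r x).2, (d.modelPair s y).2⟫_ℂ = 0 := by
  refine (inner_tensor_tensor _ _ (d.γ x) (d.γ y)).trans ?_
  rw [d.γ_inner_γ, d.eigenspace_orthogonal hrs hx hy, mul_zero]

theorem norm_checkWeight_inv_smul_le {E : Type*} [NormedAddCommGroup E] [NormedSpace ℂ E]
    {v : E} {r b : ℝ}
    (h : ‖v‖ ≤ 3 * checkWeight r * b) : ‖((checkWeight r : ℂ))⁻¹ • v‖ ≤ 3 * b := by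
  have hw := checkWeight_pos r
  rw [norm_smul, norm_inv, Complex.norm_real, Real.norm_of_nonneg hw.le, inv_mul_le_iff₀ hw]
  linarith

/-- The first component of `modelPair`, normalized. -/
def modelFst (d : DiracSystem H) (r : ℝ) : d.eigenspace r →L[ℂ] HalfLineL2 H :=
  ((checkWeight r : ℂ))⁻¹ •
    (tensor (isTestFunction_profile (sqrt_one_add_sq_pos r)).memLp ∘L
      (d.eigenspace r).subtypeL)

/-- The second component of `modelPair`, normalized. -/
def modelSnd (d : DiracSystem H) (r : ℝ) : d.eigenspace r →L[ℂ] HalfLineL2 H :=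
  ((checkWeight r : ℂ))⁻¹ •
    (tensor ((isTestFunction_profile (sqrt_one_add_sq_pos r)).memLp_deriv_add r) ∘L d.γ ∘L
      (d.eigenspace r).subtypeL)

theorem modelFst_apply (d : DiracSystem H) (r : ℝ) (x : d.eigenspace r) :
    d.modelFst r x = ((checkWeight r : ℂ))⁻¹ • (d.modelPair r x).1 := rfl

theorem modelSnd_apply (d : DiracSystem H) (r : ℝ) (x : d.eigenspace r) :
    d.modelSnd r x = ((checkWeight r : ℂ))⁻¹ • (d.modelPair r x).2 := rfl

theorem norm_modelFst_le (d : DiracSystem H) (r : ℝ) (x : d.eigenspace r) :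
    ‖d.modelFst r x‖ ≤ 3 * ‖x‖ :=
  norm_checkWeight_inv_smul_le (d.norm_modelPair_fst_le r x)

theorem norm_modelSnd_le (d : DiracSystem H) (r : ℝ) (x : d.eigenspace r) :
    ‖d.modelSnd r x‖ ≤ 3 * ‖x‖ :=
  norm_checkWeight_inv_smul_le (d.norm_modelPair_snd_le r x)

theorem modelFst_orthogonal (d : DiracSystem H) (r s : ℝ) (hrs : r ≠ s) (x : d.eigenspace r)
    (y : d.eigenspace s) : ⟪d.modelFst r x, d.modelFst s y⟫_ℂ = 0 := by
  rw [modelFst_apply, modelFst_apply, inner_smul_left, inner_smul_right,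
    d.modelPair_fst_orthogonal hrs x.2 y.2, mul_zero, mul_zero]

theorem modelSnd_orthogonal (d : DiracSystem H) (r s : ℝ) (hrs : r ≠ s) (x : d.eigenspace r)
    (y : d.eigenspace s) : ⟪d.modelSnd r x, d.modelSnd s y⟫_ℂ = 0 := by
  rw [modelSnd_apply, modelSnd_apply, inner_smul_left, inner_smul_right,
    d.modelPair_snd_orthogonal hrs x.2 y.2, mul_zero, mul_zero]

/-- The map `γ` from `ker (A - r)` to `ker (A + r)`. -/
def γEigenspace (d : DiracSystem H) (r : ℝ) : d.eigenspace r →L[ℂ] d.eigenspace (-r) :=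
  (d.γ ∘L (d.eigenspace r).subtypeL).codRestrict _ fun x => d.γ_mem_eigenspace x.2

theorem norm_γEigenspace (d : DiracSystem H) (r : ℝ) (x : d.eigenspace r) :
    ‖d.γEigenspace r x‖ = ‖x‖ :=
  d.norm_γ x

/-! ### The boundary map and the extension map -/

/-- The boundary map, with values in the Hilbert sum of the eigenspaces. -/
theorem exists_boundaryOperator (d : DiracSystem H) :
    ∃ R : HalfLineL2 H × HalfLineL2 H →L[ℂ] lp (fun r : ℝ => d.eigenspace r) 2,
      ∀ (r : ℝ) (z : d.eigenspace r) (p : HalfLineL2 H × HalfLineL2 H),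
        ⟪z, R p r⟫_ℂ = checkWeight r *
          (⟪(d.modelPair (-r) (d.γ z)).2, p.1⟫_ℂ - ⟪(d.modelPair (-r) (d.γ z)).1, p.2⟫_ℂ) := by
  -- Component `r` of the boundary value is read off by pairing with the model extension of `γ z`,
  -- an eigenvector for `-r`. Its normalizing factor is `(checkWeight (-r))⁻¹ = checkWeight r`.
  obtain ⟨W₁, hW₁⟩ := exists_adjoint_orthogonalSum
    (V := fun r => d.modelFst (-r) ∘L d.γEigenspace r) (C := 3)
    (fun r x => (d.norm_modelFst_le (-r) _).trans (by rw [← d.norm_γEigenspace r x]; rfl))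
    (fun r s hrs x y => d.modelFst_orthogonal _ _ (neg_injective.ne hrs) _ _)
  obtain ⟨W₂, hW₂⟩ := exists_adjoint_orthogonalSum
    (V := fun r => d.modelSnd (-r) ∘L d.γEigenspace r) (C := 3)
    (fun r x => (d.norm_modelSnd_le (-r) _).trans (by rw [← d.norm_γEigenspace r x]; rfl))
    (fun r s hrs x y => d.modelSnd_orthogonal _ _ (neg_injective.ne hrs) _ _)
  refine ⟨W₂ ∘L ContinuousLinearMap.fst ℂ _ _ - W₁ ∘L ContinuousLinearMap.snd ℂ _ _,
    fun r z p => ?_⟩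
  have h1 := hW₁ r z p.2
  have h2 := hW₂ r z p.1
  simp only [ContinuousLinearMap.comp_apply, modelFst_apply, modelSnd_apply, checkWeight_neg,
    inner_smul_left, Complex.conj_ofReal, Complex.ofReal_inv, inv_inv] at h1 h2
  change ⟪z, W₂ p.1 r - W₁ p.2 r⟫_ℂ = _
  rw [inner_sub_right, h1, h2, mul_sub]
  rfl

theorem _root_.IsCompactLip.continuousWithinAt_zero {d : DiracSystem H} {τ : ℝ → H}
    (hτ : IsCompactLip d τ) : ContinuousWithinAt τ (Ici 0) 0 := by
  obtain ⟨K, hK⟩ := hτ.lipschitz 1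
  refine (hK.continuousOn 0 (by simp)).mono_of_mem_nhdsWithin ?_
  exact Icc_mem_nhdsGE one_pos

variable [TopologicalSpace.SeparableSpace H]

theorem modelPair_mem_DMax_graph (d : DiracSystem H) {r : ℝ} {x : H} (hx : x ∈ d.eigenspace r) :
    d.modelPair r x ∈ d.DMax.graph :=
  d.mem_DMax_graph_of_isCompactLip
    (d.isCompactLip_smul (isTestFunction_profile (sqrt_one_add_sq_pos r)) hx)
    (coeFn_tensor _ x) (d.isDiracImage_testPair _ hx)

/-- A continuous linear extension of boundary values to the domain of `D_max`. -/
theorem exists_extensionOperator (d : DiracSystem H) :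
    ∃ S : lp (fun r : ℝ => d.eigenspace r) 2 →L[ℂ] d.DMax.graph,
      ∀ (r : ℝ) (x : d.eigenspace r),
        (S (lp.single 2 r x) : HalfLineL2 H × HalfLineL2 H) =
          ((checkWeight r : ℂ))⁻¹ • d.modelPair r x := by
  obtain ⟨W₁, hW₁⟩ := exists_adjoint_orthogonalSum d.norm_modelFst_le d.modelFst_orthogonal
  obtain ⟨W₂, hW₂⟩ := exists_adjoint_orthogonalSum d.norm_modelSnd_le d.modelSnd_orthogonal
  -- The adjoints of `W₁` and `W₂` sum the normalized model extensions and their images under `D`;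
  -- the sums remain in the graph of `D_max` because it is closed.
  set S := (ContinuousLinearMap.adjoint W₁).prod (ContinuousLinearMap.adjoint W₂)
  have hS : ∀ (r : ℝ) (x : d.eigenspace r),
      S (lp.single 2 r x) = ((checkWeight r : ℂ))⁻¹ • d.modelPair r x := by
    intro r x
    refine Prod.ext (ext_inner_right ℂ fun e => ?_) (ext_inner_right ℂ fun e => ?_)
    · refine (ContinuousLinearMap.adjoint_inner_left _ _ _).trans ?_
      rw [lp.inner_single_left, hW₁]
      rfl
    · refine (ContinuousLinearMap.adjoint_inner_left _ _ _).trans ?_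
      rw [lp.inner_single_left, hW₂]
      rfl
  have hmem : ∀ ℓ, S ℓ ∈ d.DMax.graph := by
    refine lp.eq_top_of_single_mem
      (K := d.DMax.graph.comap (S : lp (fun r : ℝ => d.eigenspace r) 2 →ₗ[ℂ]
        HalfLineL2 H × HalfLineL2 H))
      (d.isClosed_DMax_graph.preimage S.continuous) fun r x => ?_
    change S (lp.single 2 r x) ∈ d.DMax.graph
    rw [hS]
    exact d.DMax.graph.smul_mem _ (d.modelPair_mem_DMax_graph x.2)
  exact ⟨S.codRestrict _ hmem, hS⟩

/-- The pairing with the model extensions computes the value at `0`. -/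
theorem inner_modelPair_eq (d : DiracSystem H) {τ : ℝ → H}
    (hτ : ContinuousWithinAt τ (Ici 0) 0) {p : HalfLineL2 H × HalfLineL2 H}
    (hp : p ∈ d.DMax.graph) (hpτ : p.1 =ᵐ[halfLine] τ) {r : ℝ} {x : H}
    (hx : x ∈ d.eigenspace r) :
    ⟪(d.modelPair r x).2, p.1⟫_ℂ - ⟪(d.modelPair r x).1, p.2⟫_ℂ = -⟪d.γ x, τ 0⟫_ℂ := by
  refine (d.inner_testPair _ r x p.1 p.2).trans ?_
  refine integral_test_eq_neg_value_zero (α := fun t => ⟪d.γ x, τ t⟫_ℂ)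
    (memLp_inner_const _ p.1) (d.memLp_test_coefficient p.1 p.2 r x) ?_
    (ContinuousWithinAt.inner (𝕜 := ℂ) continuousWithinAt_const hτ) (isTestFunction_profile (sqrt_one_add_sq_pos r))
    (profile_zero _) fun φ φ' hφ hφ0 => d.integral_test_eq_zero hp hx hφ hφ0
  filter_upwards [hpτ] with t ht
  rw [ht]

/-! ### The kernel of the boundary map -/

/-- Here `D_max σ = g` and `D_max g = -σ`. The coefficients `a = ⟪γ y, σ⟫` and `w = ⟪y, g⟫` satisfy
`a' = s a - w`, `w' = -s w - a`, and `h₀` gives `a(0) = 0`, while `w(0)` stays free. -/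
theorem eq_zero_of_mem_deficiency (d : DiracSystem H) {σ g : HalfLineL2 H}
    (h₁ : (σ, g) ∈ d.DMax.graph) (h₂ : (g, -σ) ∈ d.DMax.graph)
    (h₀ : ∀ (r : ℝ), ∀ x ∈ d.eigenspace r,
      ⟪(d.modelPair r x).2, σ⟫_ℂ - ⟪(d.modelPair r x).1, g⟫_ℂ = 0) : σ = 0 ∧ g = 0 := by
  have key : ∀ (s : ℝ), ∀ y ∈ d.eigenspace s,
      ∀ᵐ t ∂halfLine, ⟪d.γ y, σ t⟫_ℂ = 0 ∧ ⟪y, g t⟫_ℂ = 0 := by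
    intro s y hy
    have hprof := isTestFunction_profile (sqrt_one_add_sq_pos s)
    have e1 := ae_eq_integral_of_weak_deriv (memLp_inner_const (d.γ y) σ)
      (d.memLp_test_coefficient σ g s y) hprof (profile_zero _)
      fun φ φ' hφ hφ0 => d.integral_test_eq_zero h₁ hy hφ hφ0
    rw [← d.inner_testPair hprof s y σ g] at e1
    have e0 := h₀ s y hy
    -- The second pair is tested with `γ y`, an eigenvector for `-s`; the sign in `-⟪y, g⟫` comes
    -- from `γ² = -1`.
    have e2 := ae_eq_integral_of_weak_deriv (a := fun t => -⟪y, g t⟫_ℂ)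
      (b := fun t => s * ⟪y, g t⟫_ℂ + ⟪d.γ y, σ t⟫_ℂ) (memLp_inner_const y g).neg
      (((memLp_inner_const y g).const_mul (s : ℂ)).add (memLp_inner_const (d.γ y) σ)) hprof
      (profile_zero _) (fun φ φ' hφ hφ0 => by
        rw [← d.integral_test_eq_zero h₂ (d.γ_mem_eigenspace hy) hφ hφ0]
        refine integral_congr_ae ?_
        filter_upwards [Lp.coeFn_neg σ] with t ht
        rw [ht, d.γ_sq, Pi.neg_apply, inner_neg_right, inner_neg_left]
        push_cast
        ring)
    set ℓ := ∫ t, ((profileDeriv (√(1 + s ^ 2)) t : ℂ) * -⟪y, g t⟫_ℂ +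
      (profile (√(1 + s ^ 2)) t : ℂ) * (s * ⟪y, g t⟫_ℂ + ⟪d.γ y, σ t⟫_ℂ)) ∂halfLine
    refine ae_eq_zero_of_hyperbolic_system s ℓ (memLp_inner_const (d.γ y) σ)
      (memLp_inner_const y g) ?_ ?_
    · filter_upwards [e1] with t ht
      rw [ht]
      refine (congrArg _ e0).trans ?_
      rw [sub_zero]
    · filter_upwards [e2] with t ht
      rw [← neg_neg ⟪y, g t⟫_ℂ, ht, neg_sub, sub_eq_neg_add, ← intervalIntegral.integral_neg]
      congr 2
      ext x
      ring
  constructor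
  · refine Lp.ext (Filter.EventuallyEq.trans ?_ (Lp.coeFn_zero H 2 halfLine).symm)
    refine d.ae_eq_zero_of_forall_eigenspace fun r x hx => ?_
    filter_upwards [key (-r) (d.γ x) (d.γ_mem_eigenspace hx)] with t ht
    have := ht.1
    rwa [d.γ_sq, inner_neg_left, neg_eq_zero] at this
  · refine Lp.ext (Filter.EventuallyEq.trans ?_ (Lp.coeFn_zero H 2 halfLine).symm)
    refine d.ae_eq_zero_of_forall_eigenspace fun r x hx => ?_
    filter_upwards [key r x hx] with t ht using ht.2

theorem inner_modelPair_eq_zero_of_mem_closure (d : DiracSystem H)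
    {q : HalfLineL2 H × HalfLineL2 H} (hq : q ∈ d.graphZeroC.topologicalClosure) {r : ℝ} {x : H}
    (hx : x ∈ d.eigenspace r) :
    ⟪(d.modelPair r x).2, q.1⟫_ℂ - ⟪(d.modelPair r x).1, q.2⟫_ℂ = 0 := by
  have hcl : IsClosed {q : HalfLineL2 H × HalfLineL2 H |
      ⟪(d.modelPair r x).2, q.1⟫_ℂ - ⟪(d.modelPair r x).1, q.2⟫_ℂ = 0} :=
    isClosed_eq (by fun_prop) continuous_const
  refine closure_minimal ?_ hcl hq
  rintro q ⟨τ, hτ, hτ0, hq₁, hq₂⟩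
  refine (d.inner_modelPair_eq hτ.continuousWithinAt_zero
    (d.mem_DMax_graph_of_isCompactLip hτ hq₁ hq₂) hq₁ hx).trans ?_
  rw [hτ0, inner_zero_right, neg_zero]

/-- The elements of `dom D_max` with boundary value `0` belong to the closure of `D_{0,c}`. -/
theorem mem_closure_graphZeroC (d : DiracSystem H) {p : HalfLineL2 H × HalfLineL2 H}
    (hp : p ∈ d.DMax.graph)
    (h₀ : ∀ (r : ℝ), ∀ x ∈ d.eigenspace r,
      ⟪(d.modelPair r x).2, p.1⟫_ℂ - ⟪(d.modelPair r x).1, p.2⟫_ℂ = 0) :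
    p ∈ d.graphZeroC.topologicalClosure := by
  set e := WithLp.prodContinuousLinearEquiv 2 ℂ (HalfLineL2 H) (HalfLineL2 H)
  set K : Submodule ℂ (WithLp 2 (HalfLineL2 H × HalfLineL2 H)) :=
    d.graphZeroC.topologicalClosure.comap
      (e : WithLp 2 (HalfLineL2 H × HalfLineL2 H) →ₗ[ℂ] HalfLineL2 H × HalfLineL2 H)
  have hK : IsClosed (K : Set (WithLp 2 (HalfLineL2 H × HalfLineL2 H))) :=
    d.graphZeroC.isClosed_topologicalClosure.preimage e.continuous
  have : CompleteSpace K := hK.completeSpace_coe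
  set p₀ := e (K.starProjection (e.symm p))
  have hp₀ : p₀ ∈ d.graphZeroC.topologicalClosure := K.starProjection_apply_mem (e.symm p)
  have hle : d.graphZeroC ≤ d.DMax.graph := by
    rw [← DZeroC_graph]
    exact LinearPMap.le_graph_of_le d.DZeroC_le_DMax
  have hp₀' : p₀ ∈ d.DMax.graph :=
    Submodule.topologicalClosure_minimal _ hle d.isClosed_DMax_graph hp₀
  have hn : p - p₀ ∈ d.DMax.graph := d.DMax.graph.sub_mem hp hp₀'
  -- Write `p - p₀ = (σ, g)`. Its orthogonality to the graph of `D_{0,c}` is exactly the adjoint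
  -- relation `D_max g = -σ`.
  have horth : ∀ q ∈ d.graphZeroC, ⟪(p - p₀).1, q.1⟫_ℂ + ⟪(p - p₀).2, q.2⟫_ℂ = 0 := by
    intro q hq
    have hqK : e.symm q ∈ K := by
      change e (e.symm q) ∈ d.graphZeroC.topologicalClosure
      rw [ContinuousLinearEquiv.apply_symm_apply]
      exact d.graphZeroC.le_topologicalClosure hq
    have h := K.starProjection_inner_eq_zero (e.symm p) _ hqK
    rw [WithLp.prod_inner_apply] at h
    exact h
  have hn' : ((p - p₀).2, -(p - p₀).1) ∈ d.DMax.graph := by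
    rw [mem_DMax_graph_iff]
    intro q hq
    have h := congrArg (starRingEnd ℂ) (horth q hq)
    rw [map_add, inner_conj_symm, inner_conj_symm, map_zero] at h
    rw [inner_neg_right]
    linear_combination h
  have hzero := d.eq_zero_of_mem_deficiency hn hn' fun r x hx => by
    have h1 := h₀ r x hx
    have h2 := d.inner_modelPair_eq_zero_of_mem_closure hp₀ hx
    rw [inner_sub_right, inner_sub_right]
    linear_combination h1 - h2
  have hpp : p = p₀ := sub_eq_zero.1 (Prod.ext hzero.1 hzero.2)
  rw [hpp]
  exact hp₀

end DiracSystem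

namespace DiracSystem

variable {H : Type*} [NormedAddCommGroup H] [InnerProductSpace ℂ H] [CompleteSpace H]

/-! ### Boundary conditions -/

/-- An element of the graph of `D_max` is determined by its first component, so the condition on the
domain becomes one on the graph: `D_{B,max}` is `R⁻¹(B)`. -/
theorem mem_DBMax_graph_iff (d : DiracSystem H) (R : d.DMax.graph →L[ℂ] d.CheckH)
    (B : Submodule ℂ d.CheckH) {p : HalfLineL2 H × HalfLineL2 H} :
    p ∈ (d.DBMax R B).graph ↔ ∃ h : p ∈ d.DMax.graph, R ⟨p, h⟩ ∈ B := by
  have hle : (d.DBMax R B).graph ≤ d.DMax.graph :=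
    LinearPMap.le_graph_of_le LinearPMap.domRestrict_le
  constructor
  · intro hp
    refine ⟨hle hp, ?_⟩
    obtain ⟨q, hq, hqp⟩ := (LinearPMap.mem_domain_of_mem_graph hp).1
    have : q = ⟨p, hle hp⟩ :=
      Subtype.ext (Prod.ext hqp (LinearPMap.mem_graph_snd_inj _ q.2 (hle hp) hqp))
    exact this ▸ hq
  · rintro ⟨h, hB⟩
    have hdom : p.1 ∈ (d.DBMax R B).domain :=
      ⟨⟨⟨p, h⟩, hB, rfl⟩, LinearPMap.mem_domain_of_mem_graph h⟩
    have hg := (d.DBMax R B).mem_graph ⟨p.1, hdom⟩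
    have : p = (p.1, d.DBMax R B ⟨p.1, hdom⟩) :=
      Prod.ext rfl (LinearPMap.mem_graph_snd_inj _ h (hle hg) rfl)
    rw [this]
    exact hg

theorem mem_boundaryValues_iff (d : DiracSystem H) (R : d.DMax.graph →L[ℂ] d.CheckH)
    {E : HalfLineL2 H →ₗ.[ℂ] HalfLineL2 H} (hE : E ≤ d.DMax) {X : d.CheckH} :
    X ∈ d.boundaryValues R E ↔
      ∃ p : d.DMax.graph, (p : HalfLineL2 H × HalfLineL2 H) ∈ E.graph ∧ R p = X := by
  constructor
  · rintro ⟨p, hp, rfl⟩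
    refine ⟨p, ?_, rfl⟩
    have hg := E.mem_graph ⟨p.1.1, hp⟩
    have : (p : HalfLineL2 H × HalfLineL2 H) = (p.1.1, E ⟨p.1.1, hp⟩) :=
      Prod.ext rfl (LinearPMap.mem_graph_snd_inj _ p.2 (LinearPMap.le_graph_of_le hE hg) rfl)
    rw [this]
    exact hg
  · rintro ⟨p, hp, rfl⟩
    exact ⟨p, LinearPMap.mem_domain_of_mem_graph hp, rfl⟩

theorem modelPair_smul (d : DiracSystem H) (r : ℝ) (c : ℂ) (x : H) :
    d.modelPair r (c • x) = c • d.modelPair r x := by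
  refine Prod.ext (map_smul _ c x) ?_
  change tensor _ (d.γ (c • x)) = c • tensor _ (d.γ x)
  rw [map_smul, map_smul]

theorem IsBoundaryMap.apply_eq_zero {d : DiracSystem H} {R : d.DMax.graph →L[ℂ] d.CheckH}
    (hR : d.IsBoundaryMap R) {p : d.DMax.graph}
    (hp : (p : HalfLineL2 H × HalfLineL2 H) ∈ d.graphZeroC) : R p = 0 := by
  obtain ⟨τ, hτ, hτ0, hpτ, -⟩ := hp
  refine (hR τ hτ p hpτ).unique ?_
  rw [hτ0]
  refine ⟨fun r _ => ?_, ?_, fun r _ => ?_⟩ <;> simp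

variable [TopologicalSpace.SeparableSpace H]

/-! ### Boundary maps -/

theorem graphZeroC_le_DMax_graph (d : DiracSystem H) : d.graphZeroC ≤ d.DMax.graph := by
  rw [← DZeroC_graph]
  exact LinearPMap.le_graph_of_le d.DZeroC_le_DMax

/-- There is a boundary map with a continuous linear right inverse whose kernel is the closure of
`D_{0,c}`, and the right inverse takes values in the closed span of the model extensions. -/
theorem exists_boundaryMap (d : DiracSystem H) :
    ∃ (R : d.DMax.graph →L[ℂ] d.CheckH) (S : d.CheckH →L[ℂ] d.DMax.graph),
      d.IsBoundaryMap R ∧ (∀ X, R (S X) = X) ∧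
      (∀ p, R p = 0 → (p : HalfLineL2 H × HalfLineL2 H) ∈ d.graphZeroC.topologicalClosure) ∧
      ∀ K : Submodule ℂ d.DMax.graph, IsClosed (K : Set d.DMax.graph) →
        (∀ (r : ℝ) (x : H) (hx : x ∈ d.eigenspace r),
          (⟨d.modelPair r x, d.modelPair_mem_DMax_graph hx⟩ : d.DMax.graph) ∈ K) →
        ∀ X, S X ∈ K := by
  obtain ⟨R₀, hR₀⟩ := d.exists_boundaryOperator
  obtain ⟨S₀, hS₀⟩ := d.exists_extensionOperator
  have hw : ∀ r, (checkWeight r : ℂ) ≠ 0 := fun r => by exact_mod_cast (checkWeight_pos r).ne'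
  -- On elements represented by a function continuous at `0`, `R₀` gives the components of `τ 0`
  -- multiplied by the weight, which `checkOfLp` removes.
  have hval : ∀ {τ : ℝ → H}, ContinuousWithinAt τ (Ici 0) 0 →
      ∀ {p : HalfLineL2 H × HalfLineL2 H}, p ∈ d.DMax.graph → p.1 =ᵐ[halfLine] τ →
      ∀ (r : ℝ) (z : d.eigenspace r), ⟪z, R₀ p r⟫_ℂ = checkWeight r * ⟪(z : H), τ 0⟫_ℂ := by
    intro τ hτ p hp hpτ r z
    rw [hR₀, d.inner_modelPair_eq hτ hp hpτ (d.γ_mem_eigenspace z.2), d.γ_sq, inner_neg_left,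
      neg_neg]
  have hproj : ∀ {τ : ℝ → H}, IsCompactLip d τ →
      ∀ {p : HalfLineL2 H × HalfLineL2 H}, p ∈ d.DMax.graph → p.1 =ᵐ[halfLine] τ →
      ∀ r : ℝ, ((((checkWeight r : ℂ))⁻¹ • R₀ p r : d.eigenspace r) : H) =
        (d.eigenspace r).starProjection (τ 0) := by
    intro τ hτ p hp hpτ r
    refine (Submodule.eq_starProjection_of_mem_of_inner_eq_zero (Subtype.coe_prop _)
      fun z hz => ?_).symm
    have h := hval hτ.continuousWithinAt_zero hp hpτ r ⟨z, hz⟩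
    rw [← inner_conj_symm, inner_sub_right, Submodule.coe_smul, inner_smul_right]
    change (starRingEnd ℂ) (⟪z, τ 0⟫_ℂ - (checkWeight r : ℂ)⁻¹ * ⟪(⟨z, hz⟩ : d.eigenspace r),
      R₀ p r⟫_ℂ) = 0
    rw [h, inv_mul_cancel_left₀ (hw r), sub_self, map_zero]
  have hRS : ∀ ℓ, R₀ (S₀ ℓ) = ℓ := by
    set T := R₀ ∘L d.DMax.graph.subtypeL ∘L S₀ - ContinuousLinearMap.id ℂ _
    have hT : ∀ ℓ, ℓ ∈ LinearMap.ker (T : lp (fun r : ℝ => d.eigenspace r) 2 →ₗ[ℂ]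
        lp (fun r : ℝ => d.eigenspace r) 2) := by
      refine lp.eq_top_of_single_mem T.isClosed_ker fun r x => ?_
      rw [LinearMap.mem_ker]
      change R₀ (S₀ (lp.single 2 r x)) - lp.single 2 r x = 0
      rw [hS₀, map_smul, sub_eq_zero]
      refine lp.ext (funext fun s => ext_inner_left ℂ fun z => ?_)
      have h := hval (d.isCompactLip_smul (isTestFunction_profile (sqrt_one_add_sq_pos r))
        x.2).continuousWithinAt_zero (d.modelPair_mem_DMax_graph x.2) (coeFn_tensor _ (x : H)) s z
      rw [profile_zero, Complex.ofReal_one, one_smul] at h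
      change ⟪z, (checkWeight r : ℂ)⁻¹ • R₀ (d.modelPair r x) s⟫_ℂ = _
      rw [inner_smul_right, h]
      by_cases hrs : s = r
      · subst hrs
        rw [lp.single_apply_self, inv_mul_cancel_left₀ (hw s)]
        rfl
      · rw [lp.single_apply_ne 2 _ _ hrs, inner_zero_right,
          d.eigenspace_orthogonal hrs z.2 x.2, mul_zero, mul_zero]
    exact fun ℓ => sub_eq_zero.1 (hT ℓ)
  refine ⟨d.checkOfLp ∘L R₀ ∘L d.DMax.graph.subtypeL, S₀ ∘L d.lpOfCheck, ?_, fun X => ?_,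
    fun p hp => ?_, fun K hK hKx X => ?_⟩
  · intro τ hτ p hpτ
    have h := hproj hτ p.2 hpτ
    refine ⟨fun r hr => ?_, ?_, fun r hr => ?_⟩
    · rw [← h r]
      exact congrArg Subtype.val (d.checkOfLp_component_pos (R₀ p) hr)
    · rw [← h 0]
      refine congrArg Subtype.val ((d.checkOfLp_zero (R₀ p)).trans ?_)
      simp [checkWeight]
    · rw [← h r]
      exact congrArg Subtype.val (d.checkOfLp_component_neg (R₀ p) hr)
  · change d.checkOfLp (R₀ (S₀ (d.lpOfCheck X))) = X
    rw [hRS, checkOfLp_lpOfCheck]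
  · have h0 : R₀ p = 0 := d.eq_zero_of_checkOfLp_eq_zero hp
    refine d.mem_closure_graphZeroC p.2 fun r x hx => ?_
    -- The choice `z = -γ x` at `-r` satisfies `γ z = x`, so the vanishing of `R₀ p` covers the
    -- pairing with every model extension.
    have hz : -d.γ x ∈ d.eigenspace (-r) := (d.eigenspace (-r)).neg_mem (d.γ_mem_eigenspace hx)
    have h1 := hR₀ (-r) ⟨-d.γ x, hz⟩ p
    rw [h0, lp.coeFn_zero, Pi.zero_apply, inner_zero_right, map_neg, d.γ_sq, neg_neg,
      neg_neg] at h1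
    exact (mul_eq_zero.1 h1.symm).resolve_left (hw _)
  · refine lp.eq_top_of_single_mem
      (K := K.comap (S₀ : lp (fun r : ℝ => d.eigenspace r) 2 →ₗ[ℂ] d.DMax.graph))
      (hK.preimage S₀.continuous) (fun r x => ?_) (d.lpOfCheck X)
    have hx := (d.eigenspace r).smul_mem ((checkWeight r : ℂ))⁻¹ x.2
    have h : S₀ (lp.single 2 r x) = ⟨d.modelPair r (((checkWeight r : ℂ))⁻¹ • (x : H)),
        d.modelPair_mem_DMax_graph hx⟩ :=
      Subtype.ext ((hS₀ r x).trans (d.modelPair_smul r _ _).symm)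
    change S₀ (lp.single 2 r x) ∈ K
    rw [h]
    exact hKx r _ hx

/-- Split `p = S (R p) + (p - S (R p))`. The second part lies in the closure of `D_{0,c}`, where any
boundary map vanishes by continuity. The first lies in the closed span of the model extensions,
where boundary maps agree because these are compactly supported Lipschitz functions. -/
theorem IsBoundaryMap.eq_of_le {d : DiracSystem H} {R R' : d.DMax.graph →L[ℂ] d.CheckH}
    {S : d.CheckH →L[ℂ] d.DMax.graph} (hR : d.IsBoundaryMap R) (hR' : d.IsBoundaryMap R')
    (hRS : ∀ X, R (S X) = X)
    (hker : ∀ p, R p = 0 →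
      (p : HalfLineL2 H × HalfLineL2 H) ∈ d.graphZeroC.topologicalClosure)
    (hS : ∀ K : Submodule ℂ d.DMax.graph, IsClosed (K : Set d.DMax.graph) →
        (∀ (r : ℝ) (x : H) (hx : x ∈ d.eigenspace r),
          (⟨d.modelPair r x, d.modelPair_mem_DMax_graph hx⟩ : d.DMax.graph) ∈ K) →
        ∀ X, S X ∈ K) : R' = R := by
  have hker' : ∀ p, R p = 0 → R' p = 0 := by
    intro p hp
    have hcl : p ∈ closure {q : d.DMax.graph |
        (q : HalfLineL2 H × HalfLineL2 H) ∈ d.graphZeroC} := by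
      rw [closure_subtype]
      refine closure_mono (fun q hq => ?_) (hker p hp)
      exact ⟨⟨q, d.graphZeroC_le_DMax_graph hq⟩, hq, rfl⟩
    exact closure_minimal (fun q hq => hR'.apply_eq_zero hq)
      (isClosed_eq R'.continuous continuous_const) hcl
  have hext : ∀ X, R' (S X) = X := by
    intro X
    have h := hS (LinearMap.ker ((R' - R : d.DMax.graph →L[ℂ] d.CheckH) :
      d.DMax.graph →ₗ[ℂ] d.CheckH)) (R' - R).isClosed_ker (fun r x hx => ?_) X
    · exact (sub_eq_zero.1 h).trans (hRS X)
    · have hprof := isTestFunction_profile (sqrt_one_add_sq_pos r)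
      rw [LinearMap.mem_ker]
      refine sub_eq_zero.2 (IsVector.unique
        (hR' _ (d.isCompactLip_smul hprof hx) _ (coeFn_tensor hprof.memLp x))
        (hR _ (d.isCompactLip_smul hprof hx) _ (coeFn_tensor hprof.memLp x)))
  refine ContinuousLinearMap.ext fun p => ?_
  have h1 : R (p - S (R p)) = 0 := by rw [map_sub, hRS, sub_self]
  have h2 := hker' _ h1
  rw [map_sub, hext] at h2
  exact sub_eq_zero.1 h2

end DiracSystem

/-! ### Closed extensions and closed boundary conditions -/

theorem mainTheorem12 {H : Type*} [NormedAddCommGroup H] [InnerProductSpace ℂ H]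
    [CompleteSpace H] [TopologicalSpace.SeparableSpace H] (d : DiracSystem H) :
    (∃! R : d.DMax.graph →L[ℂ] d.CheckH, d.IsBoundaryMap R) ∧
    ∀ R : d.DMax.graph →L[ℂ] d.CheckH, d.IsBoundaryMap R →
      (∀ E : HalfLineL2 H →ₗ.[ℂ] HalfLineL2 H,
        d.DZeroC ≤ E → E ≤ d.DMax → E.IsClosed →
          IsClosed (d.boundaryValues R E : Set d.CheckH) ∧
          E = d.DBMax R (d.boundaryValues R E)) ∧
      (∀ B : Submodule ℂ d.CheckH, IsClosed (B : Set d.CheckH) →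
        d.DZeroC ≤ d.DBMax R B ∧ d.DBMax R B ≤ d.DMax ∧ (d.DBMax R B).IsClosed ∧
        d.boundaryValues R (d.DBMax R B) = B) := by
  obtain ⟨R, S, hR, hRS, hker, hS⟩ := d.exists_boundaryMap
  have huniq : ∀ R', d.IsBoundaryMap R' → R' = R := fun R' hR' => hR.eq_of_le hR' hRS hker hS
  refine ⟨⟨R, hR, huniq⟩, fun R' hR' => ?_⟩
  rw [huniq R' hR']
  refine ⟨fun E h0E hE hEc => ?_, fun B hB => ⟨?_, LinearPMap.domRestrict_le, ?_, ?_⟩⟩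
  · have h0E' : d.graphZeroC ≤ E.graph := by
      rw [← d.DZeroC_graph]
      exact LinearPMap.le_graph_of_le h0E
    have hkerE : ∀ p : d.DMax.graph, R p = 0 →
        (p : HalfLineL2 H × HalfLineL2 H) ∈ E.graph := fun p hp =>
      Submodule.topologicalClosure_minimal _ h0E' hEc (hker p hp)
    -- Since `E` contains `ker R`, it is saturated for `R`: membership in `E` depends only on the
    -- boundary value.
    have hmem : ∀ p : d.DMax.graph,
        R p ∈ d.boundaryValues R E ↔ (p : HalfLineL2 H × HalfLineL2 H) ∈ E.graph := by
      intro p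
      rw [d.mem_boundaryValues_iff R hE]
      refine ⟨?_, fun hp => ⟨p, hp, rfl⟩⟩
      rintro ⟨q, hq, hqp⟩
      have h1 := E.graph.add_mem (hkerE (p - q) (by rw [map_sub, hqp, sub_self])) hq
      rwa [Submodule.coe_sub, sub_add_cancel] at h1
    constructor
    -- By saturation and `R (S X) = X`, the boundary values form the preimage of the closed graph of
    -- `E` under the continuous map `S`.
    · have hset : (d.boundaryValues R E : Set d.CheckH) =
          (fun X => (S X : HalfLineL2 H × HalfLineL2 H)) ⁻¹' (E.graph : Set _) := by
        ext X
        rw [mem_preimage, SetLike.mem_coe, SetLike.mem_coe, ← hmem, hRS]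
      rw [hset]
      exact IsClosed.preimage (continuous_subtype_val.comp S.continuous) hEc
    · refine LinearPMap.eq_of_eq_graph (Submodule.ext fun p => ?_)
      rw [d.mem_DBMax_graph_iff]
      refine ⟨fun hp => ?_, fun ⟨h, hp⟩ => (hmem ⟨p, h⟩).1 hp⟩
      exact ⟨LinearPMap.le_graph_of_le hE hp, (hmem ⟨p, _⟩).2 hp⟩
  · refine LinearPMap.le_of_le_graph ?_
    rw [d.DZeroC_graph]
    intro p hp
    refine (d.mem_DBMax_graph_iff R B).2 ⟨d.graphZeroC_le_DMax_graph hp, ?_⟩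
    rw [hR.apply_eq_zero (p := ⟨p, d.graphZeroC_le_DMax_graph hp⟩) hp]
    exact B.zero_mem
  · have hset : ((d.DBMax R B).graph : Set (HalfLineL2 H × HalfLineL2 H)) =
        Subtype.val '' (R ⁻¹' (B : Set d.CheckH)) := by
      ext p
      rw [SetLike.mem_coe, d.mem_DBMax_graph_iff]
      exact ⟨fun ⟨h, hp⟩ => ⟨⟨p, h⟩, hp, rfl⟩, fun ⟨q, hq, hqp⟩ => hqp ▸ ⟨q.2, hq⟩⟩
    change IsClosed ((d.DBMax R B).graph : Set (HalfLineL2 H × HalfLineL2 H))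
    rw [hset]
    exact d.isClosed_DMax_graph.isClosedEmbedding_subtypeVal.isClosedMap _
      (hB.preimage R.continuous)
  · ext X
    rw [d.mem_boundaryValues_iff R (E := d.DBMax R B) LinearPMap.domRestrict_le]
    constructor
    · rintro ⟨p, hp, rfl⟩
      obtain ⟨_, h⟩ := (d.mem_DBMax_graph_iff R B).1 hp
      exact h
    · intro hX
      refine ⟨S X, (d.mem_DBMax_graph_iff R B).2 ⟨(S X).2, ?_⟩, hRS X⟩
      change R (S X) ∈ B
      rwa [hRS]

end
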